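/- Let a system with finite-dimensional Hilbert space and Hamiltonian $H_S=\sum_i\epsilon_i|\epsilon_i\rangle\langle\epsilon_i|$ be coupled to a weight with Hilbert space $L^2(\mathbb R)$ (energy representation) and Hamiltonian $(H_W\psi)(E)=E\psi(E)$; let $\Delta_W=-i\,d/dE$ be the time operator, so that $(e^{-i\Delta_W\epsilon}\psi)(E)=\psi(E-\epsilon)$. Let $V_S$ be a unitary on the system, $S=e^{-iH_S\otimes\Delta_W}$, $U=S^\dagger(V_S\otimes 1)S$, and $W_S=H_S-V_S^\dagger H_SV_S$. Let $\rho_S$, $\rho_W$ be density operators with $\langle H_W^2\rangle_{\rho_W}<\infty$, and put $\rho=\rho_S\otimes\rho_W$, $\sigma=S\rho S^\dagger$, $\sigma_S=\operatorname{Tr}_W\sigma$. With $\langle A\rangle_\tau=\operatorname{Tr}[A\tau]$, $\mathrm{Cov}_\tau[A,B]=\tfrac12\langle AB+BA\rangle_\tau-\langle A\rangle_\tau\langle B\rangle_\tau$ and $\mathrm{Var}_\tau[A]=\mathrm{Cov}_\tau[A,A]$, define $$\Delta\sigma_W^2=\mathrm{Var}_\rho[U^\dagger H_WU]-\mathrm{Var}_\rho[H_W],\qquad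 F=\mathrm{Cov}_\sigma[H_S-H_W,\;V_S^\dagger H_SV_S].$$ With the Wigner function $W(E,t)=\frac1{2\pi}\int d\omega\,e^{i\omega t}\langle E-\tfrac\omega2|\rho_W|E+\tfrac\omega2\rangle$ let $$\xi_S(s)=\frac{\int dt\int dE\,e^{iEs}\,W(E,t)\,e^{-iH_St}\rho_Se^{iH_St}}{\operatorname{Tr}[e^{iH_Ws}\rho_W]}$$ for all real $s$ at which the denominator does not vanish. The state $\rho_S\otimes\rho_W$ is called semi-classical if $\xi_S(s)=\sigma_S$ for all these $s$. Then the second moments of $H_W$ and of $U^\dagger H_WU$ in $\rho$, and of $H_W$ in $\sigma$, are finite. If $\rho_S\otimes\rho_W$ is semi-classical, then $F=0$ and $$\Delta\sigma_W^2=\mathrm{Var}_{\sigma_S}[W_S]\ge 0 .$$ In particular this applies if $\rho_W=|\psi\rangle\langle\psi|$ is a Gaussian wave packet, $\psi(E)=(2\pi\varsigma^2)^{-1/4}e^{-(E-\mu)^2/(4\varsigma^2)+i\nu E}$ with $\mu,\nu\in\mathbb R$ and $\varsigma>0$, or if the system state is incoherent, $[\rho_S,H_S]=0$: in both cases $\rho_S\otimes\rho_W$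 is semi-classical. -/

import Mathlib

open MeasureTheory Complex
open scoped ENNReal ComplexOrder InnerProductSpace

noncomputable section

namespace QuantumWeight

/-! ### Traces, states, means and covariances on a Hilbert space -/

section Hilbert

variable (H : Type*) [NormedAddCommGroup H] [InnerProductSpace ℂ H] [CompleteSpace H]

/-- Index set of a fixed Hilbert basis of `H`. -/
def basisIndex : Set H := (exists_hilbertBasis ℂ H).choose

/-- A fixed Hilbert basis of `H`. -/
def onb : HilbertBasis (basisIndex H) ℂ H := (exists_hilbertBasis ℂ H).choose_spec.choose

variable {H}

/-- `Tr A = ∑ₖ ⟨bₖ, A bₖ⟩`; it is only used for trace-class operators, for which it does not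
depend on the Hilbert basis. -/
def trace (A : H →L[ℂ] H) : ℂ := ∑' k, ⟪onb H k, A (onb H k)⟫_ℂ

/-- A density operator: a positive operator whose trace is `1`. (For a positive operator the
diagonal sum converges in one Hilbert basis iff it converges in all, with the same value.) -/
structure IsDensityOperator (ρ : H →L[ℂ] H) : Prop where
  isPositive : ρ.IsPositive
  hasSum_one : HasSum (fun k => ⟪onb H k, ρ (onb H k)⟫_ℂ) 1

open Classical in
/-- The value `A x` of a partially defined operator, extended by `0` outside the domain. -/
def app (A : H →ₗ.[ℂ] H) (x : H) : H := if h : x ∈ A.domain then A ⟨x, h⟩ else 0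

/-- `⟨A²⟩_ρ = Tr[√ρ A A √ρ] = ∑ₖ ‖A √ρ bₖ‖²` is finite (and `A √ρ` is defined). -/
structure HasFiniteSecondMoment (A : H →ₗ.[ℂ] H) (ρ : H →L[ℂ] H) : Prop where
  mem_domain : ∀ k, CFC.sqrt ρ (onb H k) ∈ A.domain
  summable : Summable fun k => ‖app A (CFC.sqrt ρ (onb H k))‖ ^ 2

/-- The mean `⟨A⟩_ρ = Tr[A ρ] = Tr[√ρ A √ρ]` of a symmetric operator `A` in the state `ρ`
(the terms of the sum are real for symmetric `A`). -/
def mean (ρ : H →L[ℂ] H) (A : H →ₗ.[ℂ] H) : ℝ :=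
  ∑' k, (⟪CFC.sqrt ρ (onb H k), app A (CFC.sqrt ρ (onb H k))⟫_ℂ).re

/-- The symmetrized covariance `½⟨AB + BA⟩_ρ - ⟨A⟩_ρ ⟨B⟩_ρ` of symmetric operators, where
`½⟨AB + BA⟩_ρ = Re Tr[√ρ A B √ρ] = ∑ₖ Re ⟨A √ρ bₖ, B √ρ bₖ⟩`. -/
def cov (ρ : H →L[ℂ] H) (A B : H →ₗ.[ℂ] H) : ℝ :=
  (∑' k, (⟪app A (CFC.sqrt ρ (onb H k)), app B (CFC.sqrt ρ (onb H k))⟫_ℂ).re)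
    - mean ρ A * mean ρ B

/-- The variance `Var_ρ[A] = Cov_ρ[A, A]`. -/
def var (ρ : H →L[ℂ] H) (A : H →ₗ.[ℂ] H) : ℝ := cov ρ A A

/-- A bounded operator as a partially defined operator with full domain. -/
def ofBounded (A : H →L[ℂ] H) : H →ₗ.[ℂ] H := (A : H →ₗ[ℂ] H).toPMap ⊤

/-- `U† A U` with its natural domain `{x | U x ∈ dom A}`, for a bounded `U`. -/
def conjBy (U : H →L[ℂ] H) (A : H →ₗ.[ℂ] H) : H →ₗ.[ℂ] H where
  domain := A.domain.comap (U : H →ₗ[ℂ] H)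
  toFun := (ContinuousLinearMap.adjoint U : H →ₗ[ℂ] H) ∘ₗ A.toFun ∘ₗ
    ((U : H →ₗ[ℂ] H).restrict (p := A.domain.comap (U : H →ₗ[ℂ] H)) (q := A.domain)
      fun _ h => h)

end Hilbert

/-! ### The weight: `L²(ℝ)` in the energy representation -/

/-- The Hilbert space of the weight, `ψ(E) = ⟨E|ψ⟩`. -/
abbrev Weight : Type := Lp ℂ 2 (volume : Measure ℝ)

/-- The Hamiltonian `H_W = ∫ dE E |E⟩⟨E|`: multiplication by `E` on its maximal domain. -/
def weightHamiltonian : Weight →ₗ.[ℂ] Weight where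
  domain :=
    { carrier := {ψ | MemLp (fun E : ℝ => (E : ℂ) * ψ E) 2 volume}
      add_mem' := by
        intro a b ha hb
        refine (MemLp.add ha hb).ae_eq ?_
        filter_upwards [Lp.coeFn_add a b] with E hE
        simp only [Pi.add_apply, hE, mul_add]
      zero_mem' := by
        refine (MemLp.zero' (ε := ℂ)).ae_eq ?_
        filter_upwards [Lp.coeFn_zero ℂ 2 (volume : Measure ℝ)] with E _
        simp
      smul_mem' := by
        intro c a ha
        refine (MemLp.const_smul ha c).ae_eq ?_
        filter_upwards [Lp.coeFn_smul c a] with E hE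
        simp only [Pi.smul_apply, hE, smul_eq_mul]
        ring }
  toFun :=
    { toFun := fun ψ => MemLp.toLp (fun E : ℝ => (E : ℂ) * (ψ : Weight) E) ψ.2
      map_add' := by
        intro a b
        rw [← MemLp.toLp_add]
        apply MemLp.toLp_congr
        filter_upwards [Lp.coeFn_add (a : Weight) (b : Weight)] with E hE
        simp only [Submodule.coe_add, Pi.add_apply, hE, mul_add]
      map_smul' := by
        intro c a
        rw [RingHom.id_apply, ← MemLp.toLp_const_smul]
        apply MemLp.toLp_congr
        filter_upwards [Lp.coeFn_smul c (a : Weight)] with E hE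
        simp only [Submodule.coe_smul, Pi.smul_apply, hE, smul_eq_mul]
        ring }

/-- The bounded operator `e^{i H_W s}`: multiplication by `e^{i E s}`. -/
def expWeightHamiltonian (s : ℝ) : Weight →L[ℂ] Weight :=
  ContinuousLinearMap.holderL volume ∞ 2 2 (ContinuousLinearMap.mul ℂ ℂ)
    (MemLp.toLp (fun E : ℝ => cexp (I * E * s))
      (memLp_top_of_bound (by fun_prop) 1
        (Filter.Eventually.of_forall fun E => by
          rw [show I * (E : ℂ) * s = ((E * s : ℝ) : ℂ) * I by push_cast; ring,
            norm_exp_ofReal_mul_I])))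

/-- The displacement operator `Γ_e = e^{-i Δ_W e}`, `Γ_e |E⟩ = |E + e⟩`, that is
`(Γ_e ψ)(E) = ψ(E - e)`; its generator is the time operator `Δ_W = -i d/dE`, and
`Γ_e† H_W Γ_e = H_W + e`. -/
def displacement (e : ℝ) : Weight →L[ℂ] Weight :=
  (Lp.compMeasurePreservingₗᵢ ℂ (fun E : ℝ => E - e)
    (measurePreserving_sub_right volume e)).toContinuousLinearMap

/-- `K(x, y) = ⟨x|ρ|y⟩` is the (square-integrable) integral kernel of `ρ`. -/
structure IsKernel (ρ : Weight →L[ℂ] Weight) (K : ℝ → ℝ → ℂ) : Prop where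
  memLp : MemLp (fun p : ℝ × ℝ => K p.1 p.2) 2 volume
  apply_ae : ∀ ψ : Weight, ρ ψ =ᵐ[volume] fun x => ∫ y, K x y * ψ y

/-- The kernel `⟨x|ρ|y⟩` of `ρ`. Density operators are Hilbert–Schmidt, so that they have one,
and it is unique up to a null set. -/
def kernel (ρ : Weight →L[ℂ] Weight) : ℝ → ℝ → ℂ := Classical.epsilon (IsKernel ρ)

/-- The Wigner function
`W(E, t) = (1 / 2π) ∫ dω e^{i ω t} Tr[ρ |E + ω/2⟩⟨E - ω/2|]`. -/
def wigner (ρ : Weight →L[ℂ] Weight) (E t : ℝ) : ℂ :=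
  1 / (2 * Real.pi) * ∫ ω : ℝ, cexp (I * ω * t) * kernel ρ (E - ω / 2) (E + ω / 2)

/-- The normalized Gaussian wave function
`(2πσ²)^{-1/4} exp(-(E - μ)² / (4σ²) + iνE)`. -/
def gaussianWave (μ ν σ E : ℝ) : ℂ :=
  (((2 * Real.pi * σ ^ 2) ^ (-(1 / 4 : ℝ)) : ℝ) : ℂ) *
    cexp (-(1 / (4 * (σ : ℂ) ^ 2)) * ((E : ℂ) - μ) ^ 2 + I * ν * E)

/-- `ρ = |ψ⟩⟨ψ|` for a Gaussian wave packet `ψ`. -/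
def IsGaussianPacket (ρ : Weight →L[ℂ] Weight) : Prop :=
  ∃ (μ ν σ : ℝ) (ψ : Weight), 0 < σ ∧ ψ =ᵐ[volume] gaussianWave μ ν σ ∧
    ρ = InnerProductSpace.rankOne ℂ ψ ψ

/-! ### The system and the composite of system and weight

The finite-dimensional system is described in an eigenbasis `|εᵢ⟩`, `i : ι`, of its Hamiltonian
`H_S = ∑ᵢ εᵢ |εᵢ⟩⟨εᵢ|`, with arbitrary (possibly degenerate) energies `ε : ι → ℝ`, so that its
operators are `ι × ι` matrices. -/

section System

variable {ι : Type*} [Fintype ι] [DecidableEq ι]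

/-- `H_S = ∑ᵢ εᵢ |εᵢ⟩⟨εᵢ|`. -/
def systemHamiltonian (ε : ι → ℝ) : Matrix ι ι ℂ := Matrix.diagonal fun i => (ε i : ℂ)

/-- `V† H_S V`. -/
def rotatedHamiltonian (ε : ι → ℝ) (V : Matrix ι ι ℂ) : Matrix ι ι ℂ :=
  V.conjTranspose * systemHamiltonian ε * V

/-- The work operator `W_S = H_S - V† H_S V`. -/
def workOperator (ε : ι → ℝ) (V : Matrix ι ι ℂ) : Matrix ι ι ℂ :=
  systemHamiltonian ε - rotatedHamiltonian ε V

/-- `⟨A⟩_ρ = Tr[A ρ]` for the system. -/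
def systemMean (ρ A : Matrix ι ι ℂ) : ℂ := (A * ρ).trace

/-- `Cov_ρ[A, B] = ½⟨AB + BA⟩_ρ - ⟨A⟩_ρ ⟨B⟩_ρ` for the system. -/
def systemCov (ρ A B : Matrix ι ι ℂ) : ℂ :=
  1 / 2 * systemMean ρ (A * B + B * A) - systemMean ρ A * systemMean ρ B

/-- `Var_ρ[A] = Cov_ρ[A, A]` for the system. -/
def systemVar (ρ A : Matrix ι ι ℂ) : ℂ := systemCov ρ A A

/-- A density matrix of the system. -/
structure IsDensityMatrix (ρ : Matrix ι ι ℂ) : Prop where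
  posSemidef : ρ.PosSemidef
  trace_one : ρ.trace = 1

/-- The free evolution `e^{-i H_S t} ρ_S e^{i H_S t}`. -/
def freeEvolution (ε : ι → ℝ) (ρS : Matrix ι ι ℂ) (t : ℝ) : Matrix ι ι ℂ :=
  NormedSpace.exp (-(I * (t : ℂ)) • systemHamiltonian ε) * ρS *
    NormedSpace.exp ((I * (t : ℂ)) • systemHamiltonian ε)

variable (ι) in
/-- The composite Hilbert space `ℂ^ι ⊗ L²(ℝ)`, i.e. families `Ψᵢ(E) = ⟨εᵢ, E|Ψ⟩`. -/
abbrev Joint : Type _ := PiLp 2 fun _ : ι => Weight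

/-- The inclusion `ψ ↦ |εⱼ⟩ ⊗ ψ`. -/
def incl (j : ι) : Weight →L[ℂ] Joint ι :=
  (PiLp.continuousLinearEquiv 2 ℂ fun _ : ι => Weight).symm.toContinuousLinearMap ∘L
    ContinuousLinearMap.single ℂ (fun _ : ι => Weight) j

/-- The component map `Ψ ↦ Ψᵢ`. -/
def comp (i : ι) : Joint ι →L[ℂ] Weight := PiLp.proj 2 (fun _ : ι => Weight) i

/-- `A ⊗ B` for a system operator `A` and a bounded weight operator `B`:
`((A ⊗ B) Ψ)ᵢ = ∑ⱼ Aᵢⱼ B Ψⱼ`. -/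
def tensorOp (A : Matrix ι ι ℂ) (B : Weight →L[ℂ] Weight) : Joint ι →L[ℂ] Joint ι :=
  ∑ i, ∑ j, A i j • (incl i ∘L B ∘L comp j)

/-- The partial trace over the weight, `(Tr_W X)ᵢⱼ = Tr (⟨εᵢ| X |εⱼ⟩)`. -/
def partialTraceW (X : Joint ι →L[ℂ] Joint ι) : Matrix ι ι ℂ :=
  Matrix.of fun i j => trace (comp i ∘L X ∘L incl j)

/-- `1 ⊗ H_W`, with domain `{Ψ | ∀ i, Ψᵢ ∈ dom H_W}`. -/
def jointWeightHamiltonian : Joint ι →ₗ.[ℂ] Joint ι where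
  domain :=
    { carrier := {Ψ | ∀ i, Ψ i ∈ weightHamiltonian.domain}
      add_mem' := fun ha hb i => weightHamiltonian.domain.add_mem (ha i) (hb i)
      zero_mem' := fun _ => weightHamiltonian.domain.zero_mem
      smul_mem' := fun c _ ha i => weightHamiltonian.domain.smul_mem c (ha i) }
  toFun :=
    { toFun := fun Ψ => WithLp.toLp 2 fun i =>
        weightHamiltonian ⟨(Ψ : Joint ι) i, Ψ.2 i⟩
      map_add' := by
        intro a b
        ext1 i
        exact weightHamiltonian.map_add ⟨(a : Joint ι) i, a.2 i⟩
          ⟨(b : Joint ι) i, b.2 i⟩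
      map_smul' := by
        intro c a
        ext1 i
        exact weightHamiltonian.map_smul c ⟨(a : Joint ι) i, a.2 i⟩ }

/-- A system operator `A ⊗ 1` on the composite space. -/
def jointSystemOp (A : Matrix ι ι ℂ) : Joint ι →L[ℂ] Joint ι :=
  tensorOp A (ContinuousLinearMap.id ℂ Weight)

/-- `S = e^{-i H_S ⊗ Δ_W} = ∑ᵢ |εᵢ⟩⟨εᵢ| ⊗ e^{-i εᵢ Δ_W}`, so that `S |εᵢ, E⟩ = |εᵢ, E + εᵢ⟩`. -/
def shiftOp (ε : ι → ℝ) : Joint ι →L[ℂ] Joint ι :=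
  ∑ i, tensorOp (Matrix.single i i 1) (displacement (ε i))

/-- The energy-conserving, translation-invariant unitary `U = S† (V ⊗ 1) S`. -/
def workUnitary (ε : ι → ℝ) (V : Matrix ι ι ℂ) : Joint ι →L[ℂ] Joint ι :=
  ContinuousLinearMap.adjoint (shiftOp ε) ∘L jointSystemOp V ∘L shiftOp ε

/-- The control state `σ = S (ρ_S ⊗ ρ_W) S†`. -/
def controlState (ε : ι → ℝ) (ρS : Matrix ι ι ℂ) (ρW : Weight →L[ℂ] Weight) :
    Joint ι →L[ℂ] Joint ι :=
  shiftOp ε ∘L tensorOp ρS ρW ∘L ContinuousLinearMap.adjoint (shiftOp ε)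

/-- The control-marginal state `σ_S = Tr_W [S (ρ_S ⊗ ρ_W) S†]`. -/
def controlMarginal (ε : ι → ℝ) (ρS : Matrix ι ι ℂ) (ρW : Weight →L[ℂ] Weight) :
    Matrix ι ι ℂ :=
  partialTraceW (controlState ε ρS ρW)

/-- The denominator `Tr[e^{i H_W s} ρ_W]` of `ξ_S(s)`. -/
def xiDenominator (ρW : Weight →L[ℂ] Weight) (s : ℝ) : ℂ :=
  trace (expWeightHamiltonian s ∘L ρW)

/-- `ξ_S(s) = (∫ dt ∫ dE e^{i E s} W(E, t) e^{-i H_S t} ρ_S e^{i H_S t}) / Tr[e^{i H_W s} ρ_W]`,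
with the matrix-valued integral taken entrywise. -/
def xi (ε : ι → ℝ) (ρS : Matrix ι ι ℂ) (ρW : Weight →L[ℂ] Weight) (s : ℝ) : Matrix ι ι ℂ :=
  Matrix.of fun i j =>
    (∫ t : ℝ, (∫ E : ℝ, cexp (I * E * s) * wigner ρW E t) * freeEvolution ε ρS t i j) /
      xiDenominator ρW s

/-- `ρ_S ⊗ ρ_W` is semi-classical: `ξ_S(s) = σ_S` for every `s` at which `ξ_S(s)` is defined,
i.e. at which its denominator does not vanish (this includes a neighbourhood of `s = 0`). -/
def IsSemiclassical (ε : ι → ℝ) (ρS : Matrix ι ι ℂ) (ρW : Weight →L[ℂ] Weight) : Prop :=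
  ∀ s : ℝ, xiDenominator ρW s ≠ 0 → xi ε ρS ρW s = controlMarginal ε ρS ρW

/-- `Δσ_W² = Var_ρ[U† H_W U] - Var_ρ[H_W]` for `ρ = ρ_S ⊗ ρ_W`. -/
def varianceChange (ε : ι → ℝ) (V ρS : Matrix ι ι ℂ) (ρW : Weight →L[ℂ] Weight) : ℝ :=
  var (tensorOp ρS ρW) (conjBy (workUnitary ε V) jointWeightHamiltonian)
    - var (tensorOp ρS ρW) jointWeightHamiltonian

/-- `F = Cov_σ[H_S - H_W, V† H_S V]`. -/
def fTerm (ε : ι → ℝ) (V ρS : Matrix ι ι ℂ) (ρW : Weight →L[ℂ] Weight) : ℝ :=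
  cov (controlState ε ρS ρW)
    (ofBounded (jointSystemOp (systemHamiltonian ε)) - jointWeightHamiltonian)
    (ofBounded (jointSystemOp (rotatedHamiltonian ε V)))

end System

end QuantumWeight

end

/-! The joint state has the square root `√ρ = s ⊗ T` with `s² = ρS` and `T = √ρW`, and `T` is
Hilbert–Schmidt. Finiteness of the second moment makes `Y = H_W T` a bounded Hilbert–Schmidt
operator as well. All means and covariances thus become Hilbert–Schmidt inner products of
amplitudes, and unbounded operators occur only through statements that a pair lies in a graph.

Put `Q = S√ρ`, `P = H_W S√ρ` and `B = H_S Q - P`. Since `H_W S† = S†(H_W - H_S)` and `U†S† = S†V†`,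
one has `H_W √ρ = -S†B` and `U†H_W U √ρ = S†(W_S Q - B)`. As `S` is unitary, the variance changes by
`Var[W_S]` minus twice the covariance of `H_S - H_W` with `W_S` in `σ`. Both this covariance and `F`
vanish once `Re⟨B, A Q⟩ = -⟨H_W⟩⟨A⟩` for every Hermitian system operator `A`
(`hsInner_energyDifference`); the case `A = 1` identifies `-⟨H_W⟩` as the mean of `B`.

This orthogonality comes from semi-classicality. With `χ(ω, s) = Tr[e^{i H_W s} Γ_ω ρW]` and `ω = ε
i - ε j`, Fourier analysis of the Wigner function gives `ξ(s)ᵢⱼ = ρSᵢⱼ e^{-iωs/2} χ(ω, s) / χ(0, s)`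
(`xi_apply`), while `σ_Sᵢⱼ = ρSᵢⱼ χ(ω, 0)`. Equating the two and differentiating at `s = 0`
(`IsSemiclassical.firstOrder`) yields `ρSᵢⱼ⟨Y, Γ_ω T⟩ = σ_Sᵢⱼ(⟨Y, T⟩ + ω/2)`. The term `ω/2`
combines with the energy shift contained in `P` to form the symmetrized product of `H_S` and `A`,
which cancels the `H_S` part of `B` in real part.

A Gaussian satisfies `χ(ω, s) = C e^{iωs/2} χ(0, s)`, and an incoherent state only has entries with
`ω = 0`; in both cases `ξ` is constant in `s`. -/

noncomputable section

namespace QuantumWeight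

set_option linter.unusedSectionVars false

/-! ### Hilbert–Schmidt operators and their inner product -/

section HilbertSchmidt

variable {H₁ H₂ H₃ : Type*}
  [NormedAddCommGroup H₁] [InnerProductSpace ℂ H₁] [CompleteSpace H₁]
  [NormedAddCommGroup H₂] [InnerProductSpace ℂ H₂] [CompleteSpace H₂]
  [NormedAddCommGroup H₃] [InnerProductSpace ℂ H₃] [CompleteSpace H₃]

/-- Hilbert–Schmidt operators. -/
def IsHilbertSchmidt (X : H₁ →L[ℂ] H₂) : Prop := Summable fun k => ‖X (onb H₁ k)‖ ^ 2

/-- The Hilbert–Schmidt inner product `Tr[X† Y]`. -/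
def hsInner (X Y : H₁ →L[ℂ] H₂) : ℂ := ∑' k, ⟪X (onb H₁ k), Y (onb H₁ k)⟫_ℂ

theorem hasSum_norm_inner_onb_sq (x : H₁) :
    HasSum (fun k => ‖⟪onb H₁ k, x⟫_ℂ‖ ^ 2) (‖x‖ ^ 2) := by
  have h := Complex.hasSum_re ((onb H₁).hasSum_inner_mul_inner x x)
  have h0 : ⟪x, x⟫_ℂ = ((‖x‖ ^ 2 : ℝ) : ℂ) := by
    rw [inner_self_eq_norm_sq_to_K, Complex.ofReal_pow]
    rfl
  rw [h0, Complex.ofReal_re] at h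
  convert h using 1
  ext k
  rw [← inner_conj_symm x, ← Complex.normSq_eq_conj_mul_self, Complex.normSq_eq_norm_sq,
    Complex.ofReal_re]

theorem IsHilbertSchmidt.summable_matrix {X : H₁ →L[ℂ] H₂} (hX : IsHilbertSchmidt X) :
    Summable fun p : basisIndex H₁ × basisIndex H₂ =>
      ‖⟪onb H₂ p.2, X (onb H₁ p.1)⟫_ℂ‖ ^ 2 := by
  refine (summable_prod_of_nonneg (fun p => sq_nonneg _)).2
    ⟨fun k => (hasSum_norm_inner_onb_sq (X (onb H₁ k))).summable, ?_⟩
  refine Summable.congr hX fun k => ?_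
  exact (hasSum_norm_inner_onb_sq (X (onb H₁ k))).tsum_eq.symm

theorem IsHilbertSchmidt.adjoint {X : H₁ →L[ℂ] H₂} (hX : IsHilbertSchmidt X) :
    IsHilbertSchmidt (ContinuousLinearMap.adjoint X) := by
  have h := (summable_prod_of_nonneg (fun p => sq_nonneg _)).1
    ((Equiv.prodComm _ _).summable_iff.2 hX.summable_matrix)
  refine h.2.congr fun k => ?_
  rw [← (hasSum_norm_inner_onb_sq _).tsum_eq]
  refine tsum_congr fun l => ?_
  simp only [Equiv.prodComm_apply, Prod.swap]
  rw [ContinuousLinearMap.adjoint_inner_right, norm_inner_symm]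

theorem IsHilbertSchmidt.comp_left {X : H₁ →L[ℂ] H₂} (hX : IsHilbertSchmidt X)
    (A : H₂ →L[ℂ] H₃) : IsHilbertSchmidt (A ∘L X) := by
  refine Summable.of_nonneg_of_le (fun k => by positivity) (fun k => ?_)
    (Summable.mul_left (‖A‖ ^ 2) hX)
  rw [← mul_pow]
  gcongr
  exact A.le_opNorm _

theorem IsHilbertSchmidt.comp_right {X : H₂ →L[ℂ] H₃} (hX : IsHilbertSchmidt X)
    (A : H₁ →L[ℂ] H₂) : IsHilbertSchmidt (X ∘L A) := by
  have := (hX.adjoint.comp_left (ContinuousLinearMap.adjoint A)).adjoint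
  rwa [← ContinuousLinearMap.adjoint_comp, ContinuousLinearMap.adjoint_adjoint] at this

theorem IsHilbertSchmidt.summable_inner {X Y : H₁ →L[ℂ] H₂} (hX : IsHilbertSchmidt X)
    (hY : IsHilbertSchmidt Y) :
    Summable fun k => ⟪X (onb H₁ k), Y (onb H₁ k)⟫_ℂ := by
  refine Summable.of_norm_bounded (Summable.add hX hY) fun k => ?_
  refine (norm_inner_le_norm _ _).trans ?_
  nlinarith [sq_nonneg (‖X (onb H₁ k)‖ - ‖Y (onb H₁ k)‖), sq_nonneg ‖X (onb H₁ k)‖,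
    sq_nonneg ‖Y (onb H₁ k)‖]

theorem IsHilbertSchmidt.add {X Y : H₁ →L[ℂ] H₂} (hX : IsHilbertSchmidt X)
    (hY : IsHilbertSchmidt Y) : IsHilbertSchmidt (X + Y) := by
  refine Summable.of_nonneg_of_le (fun k => by positivity) (fun k => ?_)
    ((Summable.add hX hY).mul_left 2)
  have h := norm_add_le (X (onb H₁ k)) (Y (onb H₁ k))
  rw [_root_.add_apply]
  nlinarith [sq_nonneg (‖X (onb H₁ k)‖ - ‖Y (onb H₁ k)‖),
    norm_nonneg (X (onb H₁ k) + Y (onb H₁ k)), norm_nonneg (X (onb H₁ k)),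
    norm_nonneg (Y (onb H₁ k))]

theorem IsHilbertSchmidt.smul {X : H₁ →L[ℂ] H₂} (hX : IsHilbertSchmidt X) (c : ℂ) :
    IsHilbertSchmidt (c • X) :=
  hX.comp_left (c • ContinuousLinearMap.id ℂ H₂)

theorem IsHilbertSchmidt.neg {X : H₁ →L[ℂ] H₂} (hX : IsHilbertSchmidt X) :
    IsHilbertSchmidt (-X) := by
  simpa using hX.smul (-1)

theorem IsHilbertSchmidt.sub {X Y : H₁ →L[ℂ] H₂} (hX : IsHilbertSchmidt X)
    (hY : IsHilbertSchmidt Y) : IsHilbertSchmidt (X - Y) := by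
  rw [sub_eq_add_neg]
  exact hX.add hY.neg

theorem isHilbertSchmidt_zero : IsHilbertSchmidt (0 : H₁ →L[ℂ] H₂) := by
  simp [IsHilbertSchmidt, summable_zero]

theorem IsHilbertSchmidt.sum {κ : Type*} {s : Finset κ} {X : κ → H₁ →L[ℂ] H₂}
    (hX : ∀ i ∈ s, IsHilbertSchmidt (X i)) : IsHilbertSchmidt (∑ i ∈ s, X i) := by
  classical
  induction s using Finset.induction_on with
  | empty => simpa using isHilbertSchmidt_zero
  | insert a s ha ih =>
    rw [Finset.sum_insert ha]
    exact (hX a (by simp)).add (ih fun i hi => hX i (by simp [hi]))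

theorem hsInner_conj_symm (X Y : H₁ →L[ℂ] H₂) :
    (starRingEnd ℂ) (hsInner X Y) = hsInner Y X := by
  simp only [hsInner, Complex.conj_tsum, inner_conj_symm]

theorem hsInner_add_right {X Y Z : H₁ →L[ℂ] H₂} (hX : IsHilbertSchmidt X)
    (hY : IsHilbertSchmidt Y) (hZ : IsHilbertSchmidt Z) :
    hsInner X (Y + Z) = hsInner X Y + hsInner X Z := by
  simp only [hsInner, _root_.add_apply, inner_add_right]
  exact (hX.summable_inner hY).tsum_add (hX.summable_inner hZ)

theorem hsInner_smul_right (c : ℂ) (X Y : H₁ →L[ℂ] H₂) :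
    hsInner X (c • Y) = c * hsInner X Y := by
  simp only [hsInner, _root_.smul_apply, inner_smul_right, tsum_mul_left]

theorem hsInner_sub_right {X Y Z : H₁ →L[ℂ] H₂} (hX : IsHilbertSchmidt X)
    (hY : IsHilbertSchmidt Y) (hZ : IsHilbertSchmidt Z) :
    hsInner X (Y - Z) = hsInner X Y - hsInner X Z := by
  have h := hsInner_add_right hX hY (hZ.smul (-1))
  rw [hsInner_smul_right, neg_one_smul, ← sub_eq_add_neg] at h
  rw [h]
  ring

theorem hsInner_add_left {X Y Z : H₁ →L[ℂ] H₂} (hX : IsHilbertSchmidt X)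
    (hY : IsHilbertSchmidt Y) (hZ : IsHilbertSchmidt Z) :
    hsInner (X + Y) Z = hsInner X Z + hsInner Y Z := by
  rw [← hsInner_conj_symm, hsInner_add_right hZ hX hY, map_add, hsInner_conj_symm,
    hsInner_conj_symm]

theorem hsInner_sub_left {X Y Z : H₁ →L[ℂ] H₂} (hX : IsHilbertSchmidt X)
    (hY : IsHilbertSchmidt Y) (hZ : IsHilbertSchmidt Z) :
    hsInner (X - Y) Z = hsInner X Z - hsInner Y Z := by
  rw [← hsInner_conj_symm, hsInner_sub_right hZ hX hY, map_sub, hsInner_conj_symm,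
    hsInner_conj_symm]

theorem hsInner_smul_left (c : ℂ) (X Y : H₁ →L[ℂ] H₂) :
    hsInner (c • X) Y = (starRingEnd ℂ) c * hsInner X Y := by
  rw [← hsInner_conj_symm, hsInner_smul_right, map_mul, hsInner_conj_symm]

theorem hsInner_sum_right {κ : Type*} (s : Finset κ) {X : H₁ →L[ℂ] H₂} {Y : κ → H₁ →L[ℂ] H₂}
    (hX : IsHilbertSchmidt X) (hY : ∀ i, IsHilbertSchmidt (Y i)) :
    hsInner X (∑ i ∈ s, Y i) = ∑ i ∈ s, hsInner X (Y i) := by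
  simp only [hsInner, _root_.sum_apply, inner_sum]
  exact Summable.tsum_finsetSum fun i _ => hX.summable_inner (hY i)

/-- Both sides sum the same absolutely convergent double series of matrix coefficients, in the two
possible orders. This is the cyclicity of the trace, and it replaces any theory of trace-class
operators. -/
theorem hsInner_adjoint {X Y : H₁ →L[ℂ] H₂} (hX : IsHilbertSchmidt X)
    (hY : IsHilbertSchmidt Y) :
    hsInner X Y = hsInner (ContinuousLinearMap.adjoint Y) (ContinuousLinearMap.adjoint X) := by
  have hs : Summable fun p : basisIndex H₁ × basisIndex H₂ =>
      ⟪X (onb H₁ p.1), onb H₂ p.2⟫_ℂ * ⟪onb H₂ p.2, Y (onb H₁ p.1)⟫_ℂ := by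
    refine Summable.of_norm_bounded (hX.summable_matrix.add hY.summable_matrix) fun p => ?_
    rw [norm_mul, norm_inner_symm]
    set a := ‖⟪onb H₂ p.2, X (onb H₁ p.1)⟫_ℂ‖
    set b := ‖⟪onb H₂ p.2, Y (onb H₁ p.1)⟫_ℂ‖
    nlinarith [sq_nonneg (a - b), sq_nonneg a, sq_nonneg b]
  have h1 : ∀ k, ⟪X (onb H₁ k), Y (onb H₁ k)⟫_ℂ =
      ∑' l, ⟪X (onb H₁ k), onb H₂ l⟫_ℂ * ⟪onb H₂ l, Y (onb H₁ k)⟫_ℂ := fun k =>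
    ((onb H₂).tsum_inner_mul_inner _ _).symm
  have h2 : ∀ l, ⟪ContinuousLinearMap.adjoint Y (onb H₂ l),
      ContinuousLinearMap.adjoint X (onb H₂ l)⟫_ℂ =
      ∑' k, ⟪X (onb H₁ k), onb H₂ l⟫_ℂ * ⟪onb H₂ l, Y (onb H₁ k)⟫_ℂ := fun l => by
    rw [← (onb H₁).tsum_inner_mul_inner]
    refine tsum_congr fun k => ?_
    rw [ContinuousLinearMap.adjoint_inner_left, ContinuousLinearMap.adjoint_inner_right, mul_comm]
  simp only [hsInner, h1, h2]
  exact (Summable.tsum_comm (f := fun k l => ⟪X (onb H₁ k), onb H₂ l⟫_ℂ *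
    ⟪onb H₂ l, Y (onb H₁ k)⟫_ℂ) hs).symm

theorem hsInner_comp_left (A : H₂ →L[ℂ] H₃) (X : H₁ →L[ℂ] H₂) (Y : H₁ →L[ℂ] H₃) :
    hsInner (A ∘L X) Y = hsInner X (ContinuousLinearMap.adjoint A ∘L Y) := by
  simp only [hsInner, ContinuousLinearMap.comp_apply, ContinuousLinearMap.adjoint_inner_right]

theorem hsInner_comp_right {X : H₂ →L[ℂ] H₃} {Y : H₁ →L[ℂ] H₃} (hX : IsHilbertSchmidt X)
    (hY : IsHilbertSchmidt Y) (A : H₁ →L[ℂ] H₂) :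
    hsInner X (Y ∘L ContinuousLinearMap.adjoint A) = hsInner (X ∘L A) Y := by
  rw [hsInner_adjoint hX (hY.comp_right _), hsInner_adjoint (hX.comp_right _) hY,
    ContinuousLinearMap.adjoint_comp, ContinuousLinearMap.adjoint_comp,
    ContinuousLinearMap.adjoint_adjoint, hsInner_comp_left]

theorem hsInner_self (X : H₁ →L[ℂ] H₂) :
    hsInner X X = ((∑' k, ‖X (onb H₁ k)‖ ^ 2 : ℝ) : ℂ) := by
  simp only [hsInner, inner_self_eq_norm_sq_to_K, Complex.ofReal_tsum, Complex.ofReal_pow]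
  rfl

theorem hsInner_self_re_nonneg (X : H₁ →L[ℂ] H₂) : 0 ≤ (hsInner X X).re := by
  rw [hsInner_self, Complex.ofReal_re]
  exact tsum_nonneg fun k => by positivity

theorem hsInner_re {X Y : H₁ →L[ℂ] H₂} (hX : IsHilbertSchmidt X) (hY : IsHilbertSchmidt Y) :
    (hsInner X Y).re = ∑' k, (⟪X (onb H₁ k), Y (onb H₁ k)⟫_ℂ).re :=
  Complex.re_tsum (hX.summable_inner hY)

theorem trace_comp {X : H₁ →L[ℂ] H₂} (A : H₂ →L[ℂ] H₁) :
    trace (A ∘L X) = hsInner (ContinuousLinearMap.adjoint A) X := by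
  simp only [trace, hsInner, ContinuousLinearMap.comp_apply,
    ContinuousLinearMap.adjoint_inner_left]

end HilbertSchmidt

/-! ### Square roots of density operators -/

section DensityOperator

variable {H : Type*} [NormedAddCommGroup H] [InnerProductSpace ℂ H] [CompleteSpace H]
  {ρ : H →L[ℂ] H}

/-- The square root of a positive operator. -/
def sqrtOp (ρ : H →L[ℂ] H) : H →L[ℂ] H := CFC.sqrt ρ

theorem _root_.ContinuousLinearMap.IsPositive.sqrt_comp_sqrt (hρ : ρ.IsPositive) :
    sqrtOp ρ ∘L sqrtOp ρ = ρ :=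
  CFC.sqrt_mul_sqrt_self ρ ((ContinuousLinearMap.nonneg_iff_isPositive ρ).2 hρ)

theorem isPositive_sqrt (ρ : H →L[ℂ] H) : (sqrtOp ρ).IsPositive :=
  (ContinuousLinearMap.nonneg_iff_isPositive _).1 (CFC.sqrt_nonneg ρ)

theorem adjoint_sqrt (ρ : H →L[ℂ] H) :
    ContinuousLinearMap.adjoint (sqrtOp ρ) = sqrtOp ρ :=
  (isPositive_sqrt ρ).isSelfAdjoint.adjoint_eq

theorem sqrtOp_eq {τ : H →L[ℂ] H} (h : τ ∘L τ = ρ) (hτ : τ.IsPositive) : sqrtOp ρ = τ :=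
  CFC.sqrt_unique h ((ContinuousLinearMap.nonneg_iff_isPositive τ).2 hτ)

theorem inner_apply_eq_norm_sqrt_sq (hρ : ρ.IsPositive) (x : H) :
    ⟪x, ρ x⟫_ℂ = ((‖sqrtOp ρ x‖ ^ 2 : ℝ) : ℂ) := by
  conv_lhs => rw [← hρ.sqrt_comp_sqrt, ContinuousLinearMap.comp_apply]
  rw [← ContinuousLinearMap.adjoint_inner_left, adjoint_sqrt, inner_self_eq_norm_sq_to_K,
    Complex.ofReal_pow]
  rfl

theorem IsDensityOperator.isHilbertSchmidt_sqrt (hρ : IsDensityOperator ρ) :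
    IsHilbertSchmidt (sqrtOp ρ) := by
  have h := hρ.hasSum_one.summable
  simp only [inner_apply_eq_norm_sqrt_sq hρ.isPositive] at h
  exact Complex.summable_ofReal.1 h

theorem IsDensityOperator.hsInner_sqrt (hρ : IsDensityOperator ρ) :
    hsInner (sqrtOp ρ) (sqrtOp ρ) = 1 := by
  rw [← hρ.hasSum_one.tsum_eq, hsInner_self, Complex.ofReal_tsum]
  simp only [inner_apply_eq_norm_sqrt_sq hρ.isPositive]

/-- Cyclicity applied to `A√ρ` and `√ρ`, both of which are Hilbert–Schmidt. -/
theorem IsDensityOperator.trace_comp_self (hρ : IsDensityOperator ρ) (A : H →L[ℂ] H) :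
    trace (A ∘L ρ) = hsInner (sqrtOp ρ) (A ∘L sqrtOp ρ) := by
  have hT := hρ.isHilbertSchmidt_sqrt
  conv_lhs => rw [← hρ.isPositive.sqrt_comp_sqrt, ← ContinuousLinearMap.comp_assoc]
  rw [trace_comp, hsInner_adjoint (hT.comp_left A).adjoint hT,
    ContinuousLinearMap.adjoint_adjoint, adjoint_sqrt]

end DensityOperator

/-! ### Unbounded operators through their graphs -/

section PartialOperators

variable {H : Type*} [NormedAddCommGroup H] [InnerProductSpace ℂ H] [CompleteSpace H]

/-- Graph membership carries the domain condition along with the value, so the default `0` of `app`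
outside the domain never enters a computation. -/
theorem mem_graph_iff_app {A : H →ₗ.[ℂ] H} {x y : H} :
    (x, y) ∈ A.graph ↔ x ∈ A.domain ∧ app A x = y := by
  rw [LinearPMap.mem_graph_iff]
  constructor
  · rintro ⟨z, rfl, rfl⟩
    exact ⟨z.2, by simp [app]⟩
  · rintro ⟨hx, rfl⟩
    exact ⟨⟨x, hx⟩, rfl, by simp [app, hx]⟩

theorem mem_graph_ofBounded (A : H →L[ℂ] H) (x : H) : (x, A x) ∈ (ofBounded A).graph :=
  mem_graph_iff_app.2 ⟨Submodule.mem_top, by simp [app, ofBounded]⟩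

theorem mem_graph_sub {A B : H →ₗ.[ℂ] H} {x y z : H} (hy : (x, y) ∈ A.graph)
    (hz : (x, z) ∈ B.graph) : (x, y - z) ∈ (A - B).graph := by
  rw [LinearPMap.mem_graph_iff] at *
  obtain ⟨a, rfl, rfl⟩ := hy
  obtain ⟨b, hb, rfl⟩ := hz
  refine ⟨⟨a, a.2, ?_⟩, rfl, ?_⟩
  · simp only at hb
    rw [← hb]
    exact b.2
  · rw [LinearPMap.sub_apply]
    congr 1
    congr 1
    exact Subtype.ext hb.symm

theorem mem_graph_conjBy {A : H →ₗ.[ℂ] H} {U : H →L[ℂ] H} {x y : H}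
    (h : (U x, y) ∈ A.graph) :
    (x, ContinuousLinearMap.adjoint U y) ∈ (conjBy U A).graph := by
  rw [LinearPMap.mem_graph_iff] at *
  obtain ⟨a, ha, rfl⟩ := h
  simp only at ha
  refine ⟨⟨x, ?_⟩, rfl, ?_⟩
  · change U x ∈ A.domain
    rw [← ha]
    exact a.2
  · change ContinuousLinearMap.adjoint U (A _) = ContinuousLinearMap.adjoint U (A a)
    congr 2
    exact Subtype.ext ha.symm

/-- If `A √ρ` is a Hilbert–Schmidt operator then `⟨A²⟩_ρ` is finite. -/
theorem hasFiniteSecondMoment_of_graph {A : H →ₗ.[ℂ] H} {ρ X : H →L[ℂ] H}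
    (hX : IsHilbertSchmidt X) (h : ∀ x, (sqrtOp ρ x, X x) ∈ A.graph) :
    HasFiniteSecondMoment A ρ where
  mem_domain k := (mem_graph_iff_app.1 (h _)).1
  summable := by
    unfold sqrtOp at h
    simp only [fun k => (mem_graph_iff_app.1 (h (onb H k))).2]
    exact hX

theorem HasFiniteSecondMoment.sqrtOp_mem_domain {A : H →ₗ.[ℂ] H} {ρ : H →L[ℂ] H}
    (h : HasFiniteSecondMoment A ρ) (k : basisIndex H) : sqrtOp ρ (onb H k) ∈ A.domain :=
  h.mem_domain k

theorem HasFiniteSecondMoment.sqrtOp_summable {A : H →ₗ.[ℂ] H} {ρ : H →L[ℂ] H}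
    (h : HasFiniteSecondMoment A ρ) :
    Summable fun k => ‖app A (sqrtOp ρ (onb H k))‖ ^ 2 :=
  h.summable

theorem mean_eq_hsInner {A : H →ₗ.[ℂ] H} {ρ X : H →L[ℂ] H}
    (hρ : IsHilbertSchmidt (sqrtOp ρ)) (hX : IsHilbertSchmidt X)
    (h : ∀ x, (sqrtOp ρ x, X x) ∈ A.graph) :
    mean ρ A = (hsInner (sqrtOp ρ) X).re := by
  rw [hsInner_re hρ hX, mean]
  unfold sqrtOp at *
  simp only [fun k => (mem_graph_iff_app.1 (h (onb H k))).2]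

theorem cov_eq_hsInner {A B : H →ₗ.[ℂ] H} {ρ X Y : H →L[ℂ] H}
    (hρ : IsHilbertSchmidt (sqrtOp ρ)) (hX : IsHilbertSchmidt X) (hY : IsHilbertSchmidt Y)
    (hA : ∀ x, (sqrtOp ρ x, X x) ∈ A.graph) (hB : ∀ x, (sqrtOp ρ x, Y x) ∈ B.graph) :
    cov ρ A B = (hsInner X Y).re -
      (hsInner (sqrtOp ρ) X).re * (hsInner (sqrtOp ρ) Y).re := by
  rw [← mean_eq_hsInner hρ hX hA, ← mean_eq_hsInner hρ hY hB, hsInner_re hX hY, cov]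
  unfold sqrtOp at *
  simp only [fun k => (mem_graph_iff_app.1 (hA (onb H k))).2,
    fun k => (mem_graph_iff_app.1 (hB (onb H k))).2]

/-- Distinct orthonormal vectors are `√2` apart, so the balls of radius `1/2` around them are
disjoint. Countability later allows "for all `k`" to be moved inside "for almost every `x`". -/
theorem countable_basisIndex [SecondCountableTopology H] : Countable (basisIndex H) := by
  have hd : ∀ k l : basisIndex H, k ≠ l → 1 < dist (onb H k) (onb H l) := by
    intro k l hkl
    have h1 : ‖onb H k - onb H l‖ ^ 2 = 2 := by
      rw [@norm_sub_sq ℂ, (onb H).orthonormal.2 hkl, (onb H).orthonormal.1,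
        (onb H).orthonormal.1]
      simp
      norm_num
    rw [dist_eq_norm]
    nlinarith [norm_nonneg (onb H k - onb H l)]
  refine Pairwise.countable_of_isOpen_disjoint (s := fun k => Metric.ball (onb H k) (1 / 2))
    (fun k l hkl => ?_) (fun k => Metric.isOpen_ball) (fun k => Metric.nonempty_ball.2 (by norm_num))
  exact Metric.ball_disjoint_ball (by linarith [hd k l hkl])

end PartialOperators

/-! ### Displacements, phases and the energy operator of the weight -/

section Weight

instance : SecondCountableTopology Weight :=
  haveI : Fact ((2 : ℝ≥0∞) ≠ ∞) := ⟨by norm_num⟩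
  Lp.SecondCountableTopology

instance : Countable (basisIndex Weight) := countable_basisIndex

theorem displacement_apply_ae (e : ℝ) (ψ : Weight) :
    displacement e ψ =ᵐ[volume] fun E => ψ (E - e) :=
  Lp.coeFn_compMeasurePreserving ψ (measurePreserving_sub_right volume e)

theorem ae_comp_sub {p : ℝ → Prop} (h : ∀ᵐ E, p E) (e : ℝ) : ∀ᵐ E, p (E - e) :=
  (measurePreserving_sub_right volume e).quasiMeasurePreserving.ae h

theorem displacement_comp (e f : ℝ) :
    displacement e ∘L displacement f = displacement (e + f) := by
  ext1 ψ
  apply Lp.ext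
  filter_upwards [displacement_apply_ae e (displacement f ψ),
    ae_comp_sub (displacement_apply_ae f ψ) e, displacement_apply_ae (e + f) ψ] with E h1 h2 h3
  rw [ContinuousLinearMap.comp_apply, h1, h2, h3, sub_sub]

theorem displacement_zero : displacement 0 = ContinuousLinearMap.id ℂ Weight := by
  ext1 ψ
  apply Lp.ext
  filter_upwards [displacement_apply_ae 0 ψ] with E h
  rw [h, sub_zero, ContinuousLinearMap.id_apply]

theorem adjoint_displacement (e : ℝ) :
    ContinuousLinearMap.adjoint (displacement e) = displacement (-e) := by
  have h : ContinuousLinearMap.adjoint (displacement e) ∘L displacement e =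
      ContinuousLinearMap.id ℂ Weight :=
    ContinuousLinearMap.ext fun ψ => ext_inner_left ℂ fun φ => by
      rw [ContinuousLinearMap.comp_apply, ContinuousLinearMap.adjoint_inner_right]
      exact LinearIsometry.inner_map_map _ _ _
  calc ContinuousLinearMap.adjoint (displacement e)
      = ContinuousLinearMap.adjoint (displacement e) ∘L (displacement e ∘L displacement (-e)) := by
        rw [displacement_comp, add_neg_cancel, displacement_zero, ContinuousLinearMap.comp_id]
    _ = displacement (-e) := by
        rw [← ContinuousLinearMap.comp_assoc, h, ContinuousLinearMap.id_comp]

theorem expWeightHamiltonian_apply_ae (s : ℝ) (ψ : Weight) :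
    expWeightHamiltonian s ψ =ᵐ[volume] fun E => cexp (I * E * s) * ψ E := by
  have hm : MemLp (fun E : ℝ => cexp (I * E * s)) ∞ volume :=
    memLp_top_of_bound (by fun_prop) 1 (Filter.Eventually.of_forall fun E => by
      rw [show I * (E : ℂ) * s = ((E * s : ℝ) : ℂ) * I by push_cast; ring, norm_exp_ofReal_mul_I])
  filter_upwards [ContinuousLinearMap.coeFn_holder (r := 2) (ContinuousLinearMap.mul ℂ ℂ)
    (hm.toLp _) ψ, hm.coeFn_toLp] with E h1 h2
  exact h1.trans (by rw [h2, ContinuousLinearMap.mul_apply'])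

theorem mem_graph_weightHamiltonian {ψ θ : Weight} :
    (ψ, θ) ∈ weightHamiltonian.graph ↔ θ =ᵐ[volume] fun E => (E : ℂ) * ψ E := by
  rw [LinearPMap.mem_graph_iff]
  constructor
  · rintro ⟨z, rfl, rfl⟩
    exact MemLp.coeFn_toLp z.2
  · intro h
    have hm : MemLp (fun E : ℝ => (E : ℂ) * ψ E) 2 volume := (Lp.memLp θ).ae_eq h
    refine ⟨⟨ψ, hm⟩, rfl, ?_⟩
    apply Lp.ext
    exact (MemLp.coeFn_toLp hm).trans h.symm

/-- The covariance `H_W Γ_e = Γ_e (H_W + e)`, domains included. -/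
theorem mem_graph_displacement {ψ θ : Weight} (h : (ψ, θ) ∈ weightHamiltonian.graph) (e : ℝ) :
    (displacement e ψ, displacement e (θ + (e : ℂ) • ψ)) ∈ weightHamiltonian.graph := by
  rw [mem_graph_weightHamiltonian] at *
  filter_upwards [displacement_apply_ae e ψ, displacement_apply_ae e (θ + (e : ℂ) • ψ),
    ae_comp_sub h e, ae_comp_sub (Lp.coeFn_add θ ((e : ℂ) • ψ)) e,
    ae_comp_sub (Lp.coeFn_smul (e : ℂ) ψ) e] with E h1 h2 h3 h4 h5
  rw [h1, h2, h4, Pi.add_apply, h5, h3, Pi.smul_apply, smul_eq_mul]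
  push_cast
  ring

theorem add_I_ne_zero (E : ℝ) : (E : ℂ) + I ≠ 0 := fun h => by
  simpa using congrArg Complex.im h

theorem memLp_inv_add_I : MemLp (fun E : ℝ => ((E : ℂ) + I)⁻¹) ∞ volume :=
  memLp_top_of_bound (Measurable.aestronglyMeasurable (by fun_prop)) 1
    (Filter.Eventually.of_forall fun E => by
      rw [norm_inv]
      apply inv_le_one_of_one_le₀
      simpa using Complex.abs_im_le_norm ((E : ℂ) + I))

/-- The resolvent `(H_W + i)⁻¹`. -/
def weightResolvent : Weight →L[ℂ] Weight :=
  ContinuousLinearMap.holderL volume ∞ 2 2 (ContinuousLinearMap.mul ℂ ℂ)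
    (memLp_inv_add_I.toLp _)

theorem weightResolvent_apply_ae (ψ : Weight) :
    weightResolvent ψ =ᵐ[volume] fun E => ((E : ℂ) + I)⁻¹ * ψ E := by
  filter_upwards [ContinuousLinearMap.coeFn_holder (r := 2) (ContinuousLinearMap.mul ℂ ℂ)
    (memLp_inv_add_I.toLp _) ψ, memLp_inv_add_I.coeFn_toLp] with E h1 h2
  exact h1.trans (by rw [h2, ContinuousLinearMap.mul_apply'])

/-- Describes the graph by an equation between bounded operators, which therefore passes to limits:
a usable form of the closedness of `H_W`. -/
theorem mem_graph_iff_resolvent {ψ θ : Weight} :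
    (ψ, θ) ∈ weightHamiltonian.graph ↔ weightResolvent (θ + I • ψ) = ψ := by
  rw [mem_graph_weightHamiltonian]
  constructor
  · intro h
    apply Lp.ext
    filter_upwards [h, weightResolvent_apply_ae (θ + I • ψ), Lp.coeFn_add θ (I • ψ),
      Lp.coeFn_smul I ψ] with E h1 h2 h3 h4
    rw [h2, h3, Pi.add_apply, h1, h4, Pi.smul_apply, smul_eq_mul, ← add_mul,
      inv_mul_cancel_left₀ (add_I_ne_zero E)]
  · intro h
    have h0 : (weightResolvent (θ + I • ψ) : ℝ → ℂ) =ᵐ[volume] ψ := by rw [h]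
    filter_upwards [h0, weightResolvent_apply_ae (θ + I • ψ), Lp.coeFn_add θ (I • ψ),
      Lp.coeFn_smul I ψ] with E h1 h2 h3 h4
    rw [h2, h3, Pi.add_apply, h4, Pi.smul_apply, smul_eq_mul] at h1
    rw [inv_mul_eq_iff_eq_mul₀ (add_I_ne_zero E)] at h1
    linear_combination h1

end Weight

/-! ### Extending a square-summable family to a bounded operator -/

section BasisImages

variable {H₁ H₂ : Type*}
  [NormedAddCommGroup H₁] [InnerProductSpace ℂ H₁] [CompleteSpace H₁]
  [NormedAddCommGroup H₂] [InnerProductSpace ℂ H₂] [CompleteSpace H₂]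

/-- A square-summable family is the image of the Hilbert basis under a bounded operator. -/
theorem exists_hasSum_inner_smul {v : basisIndex H₁ → H₂} (hv : Summable fun k => ‖v k‖ ^ 2) :
    ∃ X : H₁ →L[ℂ] H₂, ∀ x, HasSum (fun k => ⟪onb H₁ k, x⟫_ℂ • v k) (X x) := by
  -- Cauchy–Schwarz against Parseval's identity for `x`: this gives absolute convergence and the
  -- operator bound at once.
  have key : ∀ x : H₁, (Summable fun k => ‖⟪onb H₁ k, x⟫_ℂ • v k‖) ∧
      ∑' k, ‖⟪onb H₁ k, x⟫_ℂ • v k‖ ≤ √(∑' k, ‖v k‖ ^ 2) * ‖x‖ := by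
    intro x
    have h := hasSum_norm_inner_onb_sq x
    have h2 := Real.summable_and_inner_le_Lp_mul_Lq_tsum_of_nonneg
      (f := fun k => ‖⟪onb H₁ k, x⟫_ℂ‖) (g := fun k => ‖v k‖) Real.HolderConjugate.two_two
      (fun k => norm_nonneg _) (fun k => norm_nonneg _)
      (by simpa only [Real.rpow_two] using h.summable) (by simpa only [Real.rpow_two] using hv)
    simp only [Real.rpow_two, h.tsum_eq, ← norm_smul, ← Real.sqrt_eq_rpow,
      Real.sqrt_sq (norm_nonneg x)] at h2
    exact ⟨h2.1, h2.2.trans_eq (mul_comm _ _)⟩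
  have hs := fun x => (key x).1.of_norm
  refine ⟨LinearMap.mkContinuous
    { toFun := fun x => ∑' k, ⟪onb H₁ k, x⟫_ℂ • v k
      map_add' := fun x y => by
        simp only [inner_add_right, add_smul]
        exact (hs x).tsum_add (hs y)
      map_smul' := fun c x => by
        simp only [inner_smul_right, mul_smul, RingHom.id_apply]
        exact (hs x).tsum_const_smul c } _ fun x =>
      (norm_tsum_le_tsum_norm (key x).1).trans (key x).2, fun x => (hs x).hasSum⟩

end BasisImages

/-- If `⟨H_W²⟩_ρ` is finite then `H_W √ρ` is everywhere defined and Hilbert–Schmidt. -/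
theorem exists_weightHamiltonian_comp_sqrt {ρ : Weight →L[ℂ] Weight}
    (h : HasFiniteSecondMoment weightHamiltonian ρ) :
    ∃ Y : Weight →L[ℂ] Weight, IsHilbertSchmidt Y ∧
      ∀ ψ, (sqrtOp ρ ψ, Y ψ) ∈ weightHamiltonian.graph := by
  obtain ⟨Y, hY⟩ := exists_hasSum_inner_smul h.sqrtOp_summable
  have hg : ∀ ψ, (sqrtOp ρ ψ, Y ψ) ∈ weightHamiltonian.graph := by
    intro ψ
    -- The hypothesis concerns basis vectors only; in resolvent form it extends to all `ψ` by
    -- continuity and linearity.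
    rw [mem_graph_iff_resolvent]
    have h1 : HasSum (fun k => ⟪onb Weight k, ψ⟫_ℂ • sqrtOp ρ (onb Weight k))
        (sqrtOp ρ ψ) := by
      have := (sqrtOp ρ).hasSum ((onb Weight).hasSum_repr ψ)
      simpa only [map_smul, HilbertBasis.repr_apply_apply] using this
    refine HasSum.unique ?_ h1
    have h2 := weightResolvent.hasSum ((hY ψ).add (h1.const_smul I))
    convert h2 using 2 with k
    rw [smul_comm, ← smul_add, map_smul, mem_graph_iff_resolvent.1
      (mem_graph_iff_app.2 ⟨h.sqrtOp_mem_domain k, rfl⟩)]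
  refine ⟨Y, ?_, hg⟩
  refine h.sqrtOp_summable.congr fun k => ?_
  rw [(mem_graph_iff_app.1 (hg _)).2]

/-! ### Plancherel's theorem for Fourier integrals of vector-valued functions -/

section Plancherel

open FourierTransform SchwartzMap
open scoped ContDiff

variable {F : Type*} [NormedAddCommGroup F] [InnerProductSpace ℂ F] [CompleteSpace F]

/-- The `L²` Fourier transform is given by the Fourier integral on `L¹ ∩ L²`. -/
theorem fourier_toLp_ae {f : ℝ → F} (hf : Integrable f) (hf2 : MemLp f 2) :
    (𝓕 (hf2.toLp f) : Lp F 2 (volume : Measure ℝ)) =ᵐ[volume] 𝓕 f := by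
  have hcont : Continuous (𝓕 f) :=
    VectorFourier.fourierIntegral_continuous Real.continuous_fourierChar (by fun_prop) hf
  refine ae_eq_of_integral_contDiff_smul_eq
    ((Lp.memLp (𝓕 (hf2.toLp f))).locallyIntegrable (by norm_num)) hcont.locallyIntegrable
    fun g hg hgc => ?_
  have hg₁ : HasCompactSupport (Complex.ofRealCLM ∘ g) := hgc.comp_left rfl
  have hg₂ : ContDiff ℝ ∞ (Complex.ofRealCLM ∘ g) := by fun_prop
  set G : 𝓢(ℝ, ℂ) := hg₁.toSchwartzMap hg₂
  -- The `L²` transform agrees with the distributional one; for an integrable `f` the transform can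
  -- be moved from the test function back to `f` under the integral.
  have h1 := congrArg (fun T : TemperedDistribution ℝ F => T G)
    (Lp.fourier_toTemperedDistribution_eq (hf2.toLp f))
  simp only [TemperedDistribution.fourier_apply, Lp.toTemperedDistribution_apply] at h1
  have h2 : ∫ x, (𝓕 G : 𝓢(ℝ, ℂ)) x • (hf2.toLp f) x = ∫ x, (𝓕 (G : ℝ → ℂ)) x • f x := by
    refine integral_congr_ae ?_
    filter_upwards [hf2.coeFn_toLp] with x hx
    rw [hx, SchwartzMap.fourier_coe]
  have h3 : ∫ x, (𝓕 (G : ℝ → ℂ)) x • f x = ∫ x, G x • (𝓕 f) x := by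
    refine (VectorFourier.integral_fourierIntegral_smul_eq_flip (L := innerₗ ℝ)
      Real.continuous_fourierChar (by fun_prop) G.integrable hf).trans ?_
    simp only [Real.fourier_eq, VectorFourier.fourierIntegral, LinearMap.flip_apply, innerₗ_apply_apply,
      real_inner_comm]
  rw [h2, h3] at h1
  exact h1.symm

/-- Plancherel's theorem on `L¹ ∩ L²`. -/
theorem integral_inner_fourier_fourier {f g : ℝ → F} (hf : Integrable f) (hf2 : MemLp f 2)
    (hg : Integrable g) (hg2 : MemLp g 2) :
    ∫ x, ⟪𝓕 f x, 𝓕 g x⟫_ℂ = ∫ x, ⟪f x, g x⟫_ℂ := by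
  have h := Lp.inner_fourier_eq (hf2.toLp f) (hg2.toLp g)
  rw [L2.inner_def, L2.inner_def] at h
  refine (integral_congr_ae ?_).trans (h.trans (integral_congr_ae ?_))
  · filter_upwards [fourier_toLp_ae hf hf2, fourier_toLp_ae hg hg2] with x h1 h2
    rw [h1, h2]
  · filter_upwards [hf2.coeFn_toLp, hg2.coeFn_toLp] with x h1 h2
    rw [h1, h2]

end Plancherel

/-- Since `kernel` is a choice among all kernels, this uniqueness is what allows it to be replaced
by the explicit one of `isKernel_wave`. -/
theorem IsKernel.ae_eq {ρ : Weight →L[ℂ] Weight} {K L : ℝ → ℝ → ℂ} (hK : IsKernel ρ K)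
    (hL : IsKernel ρ L) : ∀ᵐ p : ℝ × ℝ, K p.1 p.2 = L p.1 p.2 := by
  have slice : ∀ {M : ℝ → ℝ → ℂ}, MemLp (fun p : ℝ × ℝ => M p.1 p.2) 2 volume →
      ∀ᵐ x, MemLp (M x) 2 volume := by
    intro M hM
    have h1 := (hM.integrable_norm_pow (by norm_num)).prod_right_ae
    filter_upwards [h1, hM.1.prodMk_left] with x hx hx2
    exact (memLp_two_iff_integrable_sq_norm hx2).2 hx
  -- Countably many test vectors keep the exceptional set of `x` null, and their density then
  -- determines the whole slice.
  have hd : ∀ᵐ x, ∀ n, ∫ y, K x y * TopologicalSpace.denseSeq Weight n y =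
      ∫ y, L x y * TopologicalSpace.denseSeq Weight n y := by
    rw [ae_all_iff]
    intro n
    filter_upwards [hK.apply_ae (TopologicalSpace.denseSeq Weight n),
      hL.apply_ae (TopologicalSpace.denseSeq Weight n)] with x h1 h2
    rw [← h1, ← h2]
  have hae : ∀ᵐ x, ∀ᵐ y, K x y = L x y := by
    filter_upwards [slice hK.memLp, slice hL.memLp, hd] with x h1 h2 h3
    have hD : MemLp (fun y => (starRingEnd ℂ) (K x y - L x y)) 2 volume := (h1.sub h2).star
    have h0 : hD.toLp _ = 0 := by
      refine Dense.eq_zero_of_inner_left ℂ (TopologicalSpace.denseRange_denseSeq Weight) ?_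
      rintro _ ⟨n, rfl⟩
      rw [L2.inner_def]
      have e1 : ∀ᵐ y, ⟪hD.toLp _ y, TopologicalSpace.denseSeq Weight n y⟫_ℂ =
          K x y * TopologicalSpace.denseSeq Weight n y -
            L x y * TopologicalSpace.denseSeq Weight n y := by
        filter_upwards [hD.coeFn_toLp] with y hy
        rw [hy, RCLike.inner_apply, Complex.conj_conj]
        ring
      rw [integral_congr_ae e1, integral_sub, h3 n, sub_self]
      · exact h1.integrable_mul (Lp.memLp _)
      · exact h2.integrable_mul (Lp.memLp _)
    have h4 : (hD.toLp _ : ℝ → ℂ) =ᵐ[volume] 0 := by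
      rw [h0]
      exact Lp.coeFn_zero _ _ _
    filter_upwards [h4, hD.coeFn_toLp] with y h5 h6
    rw [h6] at h5
    exact sub_eq_zero.1 ((map_eq_zero _).1 h5)
  have hm : AEMeasurable (fun p : ℝ × ℝ => ‖K p.1 p.2 - L p.1 p.2‖ₑ)
      ((volume : Measure ℝ).prod volume) := (hK.memLp.1.sub hL.memLp.1).enorm
  have hz : ∫⁻ p : ℝ × ℝ, ‖K p.1 p.2 - L p.1 p.2‖ₑ ∂((volume : Measure ℝ).prod volume) = 0 := by
    rw [lintegral_prod _ hm]
    refine (lintegral_congr_ae (g := 0) ?_).trans (by simp)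
    filter_upwards [hae] with x hx
    refine (lintegral_congr_ae (g := 0) ?_).trans (by simp)
    filter_upwards [hx] with y hy
    simp [hy]
  rw [lintegral_eq_zero_iff' hm] at hz
  filter_upwards [hz] with p hp
  simpa [sub_eq_zero] using hp

/-! ### Hilbert–Schmidt operators as `ℓ²`-valued wave functions -/

section Wave

open Classical in
/-- The unit vector of `ℓ²` with index `k`. -/
def unitVec (k : basisIndex Weight) : lp (fun _ : basisIndex Weight => ℂ) 2 := lp.single 2 k 1

theorem inner_unitVec (k : basisIndex Weight) (f : lp (fun _ : basisIndex Weight => ℂ) 2) :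
    ⟪unitVec k, f⟫_ℂ = f k := by
  classical
  rw [unitVec]
  convert lp.inner_single_left (𝕜 := ℂ) k (1 : ℂ) f using 1
  simp

theorem inner_unitVec_unitVec (k l : basisIndex Weight) [Decidable (l = k)] :
    ⟪unitVec k, unitVec l⟫_ℂ = if l = k then 1 else 0 := by
  classical
  rw [inner_unitVec, unitVec, lp.single_apply]
  split_ifs with h
  · subst h; simp
  · simp [Ne.symm h]

/-- The Hilbert space of `ℓ²`-valued wave functions. -/
abbrev Waves : Type := Lp (lp (fun _ : basisIndex Weight => ℂ) 2) 2 (volume : Measure ℝ)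

/-- `ψ ↦ ψ(x) eₖ`. -/
def coordEmb (k : basisIndex Weight) : Weight →L[ℂ] Waves :=
  (ContinuousLinearMap.toSpanSingleton ℂ (unitVec k)).compLpL 2 volume

/-- `Φ ↦ ⟨v, Φ(x)⟩`. -/
def coordPair (v : lp (fun _ : basisIndex Weight => ℂ) 2) : Waves →L[ℂ] Weight :=
  (innerSL ℂ v).compLpL 2 volume

theorem coordEmb_apply_ae (k : basisIndex Weight) (ψ : Weight) :
    coordEmb k ψ =ᵐ[volume] fun x => ψ x • unitVec k := by
  filter_upwards [ContinuousLinearMap.coeFn_compLpL (p := 2) (μ := volume)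
    (ContinuousLinearMap.toSpanSingleton ℂ (unitVec k)) ψ] with x hx
  exact hx

theorem coordPair_apply_ae (v : lp (fun _ : basisIndex Weight => ℂ) 2) (Φ : Waves) :
    coordPair v Φ =ᵐ[volume] fun x => ⟪v, Φ x⟫_ℂ := by
  filter_upwards [ContinuousLinearMap.coeFn_compLpL (p := 2) (μ := volume)
    (innerSL ℂ v) Φ] with x hx
  exact hx

theorem coordPair_coordEmb (v : lp (fun _ : basisIndex Weight => ℂ) 2) (k : basisIndex Weight)
    (ψ : Weight) : coordPair v (coordEmb k ψ) = ⟪v, unitVec k⟫_ℂ • ψ := by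
  apply Lp.ext
  filter_upwards [coordPair_apply_ae v (coordEmb k ψ), coordEmb_apply_ae k ψ,
    Lp.coeFn_smul ⟪v, unitVec k⟫_ℂ ψ] with x h1 h2 h3
  rw [h1, h2, h3, inner_smul_right, Pi.smul_apply, smul_eq_mul, mul_comm]

theorem inner_coordEmb (k : basisIndex Weight) (ψ : Weight) (Φ : Waves) :
    ⟪coordEmb k ψ, Φ⟫_ℂ = ⟪ψ, coordPair (unitVec k) Φ⟫_ℂ := by
  rw [L2.inner_def, L2.inner_def]
  refine integral_congr_ae ?_
  filter_upwards [coordEmb_apply_ae k ψ, coordPair_apply_ae (unitVec k) Φ] with x h1 h2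
  rw [h1, h2, inner_smul_left, RCLike.inner_apply, mul_comm]

theorem inner_coordEmb_coordEmb (k l : basisIndex Weight) [Decidable (l = k)] (ψ φ : Weight) :
    ⟪coordEmb k ψ, coordEmb l φ⟫_ℂ = if l = k then ⟪ψ, φ⟫_ℂ else 0 := by
  rw [inner_coordEmb, coordPair_coordEmb, inner_unitVec_unitVec, inner_smul_right]
  split_ifs <;> simp

/-- The wave function `x ↦ (X bₖ (x))ₖ` with values in `ℓ²` of a Hilbert–Schmidt operator `X`. -/
def wave (X : Weight →L[ℂ] Weight) : Waves := ∑' k, coordEmb k (X (onb Weight k))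

theorem norm_coordEmb (k : basisIndex Weight) (ψ : Weight) : ‖coordEmb k ψ‖ = ‖ψ‖ := by
  classical
  have h := inner_coordEmb_coordEmb k k ψ ψ
  rw [if_pos rfl] at h
  rw [@norm_eq_sqrt_re_inner ℂ, @norm_eq_sqrt_re_inner ℂ _ _ _ _ ψ, h]

/-- Components carried by different unit vectors of `ℓ²` are orthogonal, so square summability of
the norms suffices. -/
theorem hasSum_wave {X : Weight →L[ℂ] Weight} (hX : IsHilbertSchmidt X) :
    HasSum (fun k => coordEmb k (X (onb Weight k))) (wave X) := by
  classical
  let V : ∀ _ : basisIndex Weight, Weight →ₗᵢ[ℂ] Waves := fun k =>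
    ⟨(coordEmb k : Weight →ₗ[ℂ] Waves), norm_coordEmb k⟩
  have hV : OrthogonalFamily ℂ (fun _ : basisIndex Weight => Weight) V := by
    intro k l hkl ψ φ
    exact (inner_coordEmb_coordEmb k l ψ φ).trans (if_neg hkl.symm)
  exact ((hV.summable_iff_norm_sq_summable fun k => X (onb Weight k)).2 hX).hasSum

theorem hasSum_coordPair_wave {X : Weight →L[ℂ] Weight} (hX : IsHilbertSchmidt X)
    (v : lp (fun _ : basisIndex Weight => ℂ) 2) :
    HasSum (fun k => (starRingEnd ℂ) (v k) • X (onb Weight k)) (coordPair v (wave X)) := by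
  convert (coordPair v).hasSum (hasSum_wave hX) using 2 with k
  rw [coordPair_coordEmb, ← inner_conj_symm, inner_unitVec]

theorem coordPair_unitVec_wave {X : Weight →L[ℂ] Weight} (hX : IsHilbertSchmidt X)
    (k : basisIndex Weight) : coordPair (unitVec k) (wave X) = X (onb Weight k) := by
  classical
  refine (hasSum_coordPair_wave hX (unitVec k)).unique ?_
  convert hasSum_single k fun l hl => ?_ using 1
  · rw [← inner_unitVec, inner_unitVec_unitVec]
    simp
  · rw [← inner_unitVec, inner_unitVec_unitVec, if_neg hl.symm]
    simp

theorem wave_coord_ae {X : Weight →L[ℂ] Weight} (hX : IsHilbertSchmidt X) :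
    ∀ᵐ x, ∀ k, wave X x k = X (onb Weight k) x := by
  rw [ae_all_iff]
  intro k
  filter_upwards [coordPair_apply_ae (unitVec k) (wave X)] with x hx
  rw [← inner_unitVec, ← hx, coordPair_unitVec_wave hX]

/-- Turns Hilbert–Schmidt inner products into integrals over the energy, where displacements and
phases act pointwise and mixed states are handled just like pure ones. -/
theorem inner_wave {X Y : Weight →L[ℂ] Weight} (hX : IsHilbertSchmidt X)
    (hY : IsHilbertSchmidt Y) : ⟪wave X, wave Y⟫_ℂ = hsInner X Y := by
  have h := (hasSum_wave hX).map (innerₛₗ ℂ |>.flip (wave Y) : Waves →ₛₗ[starRingEnd ℂ] ℂ)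
    (by simp only [innerₛₗ]; exact continuous_id.inner continuous_const)
  refine h.tsum_eq.symm.trans (tsum_congr fun k => ?_)
  change ⟪coordEmb k (X (onb Weight k)), wave Y⟫_ℂ = _
  rw [inner_coordEmb, coordPair_unitVec_wave hY]

theorem wave_displacement_ae {X : Weight →L[ℂ] Weight} (hX : IsHilbertSchmidt X) (e : ℝ) :
    wave (displacement e ∘L X) =ᵐ[volume] fun x => wave X (x - e) := by
  have h : ∀ᵐ x, ∀ k, displacement e (X (onb Weight k)) x = X (onb Weight k) (x - e) :=
    ae_all_iff.2 fun k => displacement_apply_ae e _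
  filter_upwards [wave_coord_ae (hX.comp_left (displacement e)),
    ae_comp_sub (wave_coord_ae hX) e, h] with x h1 h2 h3
  ext k
  rw [h1, h2, ← h3, ContinuousLinearMap.comp_apply]

theorem wave_exp_ae {X : Weight →L[ℂ] Weight} (hX : IsHilbertSchmidt X) (s : ℝ) :
    wave (expWeightHamiltonian s ∘L X) =ᵐ[volume] fun x => cexp (I * x * s) • wave X x := by
  have h : ∀ᵐ x : ℝ, ∀ k, expWeightHamiltonian s (X (onb Weight k)) x =
      cexp (I * x * s) * X (onb Weight k) x :=
    ae_all_iff.2 fun k => expWeightHamiltonian_apply_ae s _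
  filter_upwards [wave_coord_ae (hX.comp_left (expWeightHamiltonian s)),
    wave_coord_ae hX, h] with x h1 h2 h3
  ext k
  rw [h1, lp.coeFn_smul, Pi.smul_apply, h2, smul_eq_mul, ← h3, ContinuousLinearMap.comp_apply]

theorem wave_weightHamiltonian_ae {X Y : Weight →L[ℂ] Weight} (hX : IsHilbertSchmidt X)
    (hY : IsHilbertSchmidt Y) (h : ∀ ψ, (X ψ, Y ψ) ∈ weightHamiltonian.graph) :
    wave Y =ᵐ[volume] fun x => (x : ℂ) • wave X x := by
  have h : ∀ᵐ x : ℝ, ∀ k, Y (onb Weight k) x = (x : ℂ) * X (onb Weight k) x :=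
    ae_all_iff.2 fun k => mem_graph_weightHamiltonian.1 (h _)
  filter_upwards [wave_coord_ae hY, wave_coord_ae hX, h] with x h1 h2 h3
  ext k
  rw [h1, lp.coeFn_smul, Pi.smul_apply, h2, smul_eq_mul, ← h3]

/-- Write the wave function as `(x + i)⁻¹` times `(x + i)Φ(x)`. The first factor is in `L²`, and the
second is too because `xΦ` is the wave function of `Y`; the product is in `L¹`. -/
theorem integrable_wave {X Y : Weight →L[ℂ] Weight} (hX : IsHilbertSchmidt X)
    (hY : IsHilbertSchmidt Y) (h : ∀ ψ, (X ψ, Y ψ) ∈ weightHamiltonian.graph) :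
    Integrable (wave X) := by
  have h1 : MemLp (fun x : ℝ => ((x : ℂ) + I)⁻¹) 2 volume := by
    rw [memLp_two_iff_integrable_sq_norm memLp_inv_add_I.1]
    convert integrable_inv_one_add_sq using 2 with x
    rw [norm_inv, inv_pow, ← Complex.normSq_eq_norm_sq, Complex.normSq_apply]
    simp
    ring
  have h2 : MemLp (fun x => wave Y x + I • wave X x) 2 volume :=
    (Lp.memLp (wave Y)).add ((Lp.memLp (wave X)).const_smul I)
  have h3 := memLp_one_iff_integrable.1 (h2.smul h1 (r := 1))
  refine h3.congr ?_
  filter_upwards [wave_weightHamiltonian_ae hX hY h] with x hx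
  rw [Pi.smul_apply', hx, ← add_smul, smul_smul, inv_mul_cancel₀ (add_I_ne_zero x), one_smul]

/-- The integral kernel `⟨x|T T†|y⟩` in terms of the wave function of a self-adjoint `T`. -/
theorem isKernel_wave {ρ T : Weight →L[ℂ] Weight} (hT : IsHilbertSchmidt T)
    (hT' : ContinuousLinearMap.adjoint T = T) (h : T ∘L T = ρ) :
    IsKernel ρ fun x y => ⟪wave T y, wave T x⟫_ℂ where
  memLp := by
    have h1 := Lp.memLp (wave T)
    have hm : AEStronglyMeasurable (fun p : ℝ × ℝ => ⟪wave T p.2, wave T p.1⟫_ℂ)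
        ((volume : Measure ℝ).prod volume) := h1.1.comp_snd.inner h1.1.comp_fst
    refine (memLp_two_iff_integrable_sq_norm hm).2 ?_
    have h2 := (memLp_two_iff_integrable_sq_norm h1.1).1 h1
    refine (h2.mul_prod h2).mono' (hm.norm.pow 2) (Filter.Eventually.of_forall fun p => ?_)
    rw [norm_pow, norm_norm, ← mul_pow]
    gcongr
    rw [mul_comm]
    exact norm_inner_le_norm _ _
  apply_ae ψ := by
    have hint : Integrable fun y => (starRingEnd ℂ) (ψ y) • wave T y :=
      memLp_one_iff_integrable.1 ((Lp.memLp (wave T)).smul (Lp.memLp ψ).star (r := 1))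
    -- This `ℓ²` vector has coordinates `⟨ψ, T bₖ⟩`, so pairing it with the wave function reproduces
    -- the expansion of `T(Tψ)` in the basis.
    set v := ∫ y, (starRingEnd ℂ) (ψ y) • wave T y with hv
    have hvk : ∀ k, v k = ⟪ψ, T (onb Weight k)⟫_ℂ := by
      intro k
      rw [← inner_unitVec, hv, ← integral_inner hint, ← coordPair_unitVec_wave hT, L2.inner_def]
      refine integral_congr_ae ?_
      filter_upwards [coordPair_apply_ae (unitVec k) (wave T)] with x hx
      rw [hx, inner_smul_right, RCLike.inner_apply, mul_comm]
    have hρ : ρ ψ = coordPair v (wave T) := by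
      refine HasSum.unique ?_ (hasSum_coordPair_wave hT v)
      have h1 := T.hasSum ((onb Weight).hasSum_repr (T ψ))
      rw [← h, ContinuousLinearMap.comp_apply]
      convert h1 using 2 with k
      rw [map_smul, HilbertBasis.repr_apply_apply, hvk, inner_conj_symm,
        ← ContinuousLinearMap.adjoint_inner_right, hT']
    rw [hρ]
    filter_upwards [coordPair_apply_ae v (wave T)] with x hx
    rw [hx, ← inner_conj_symm, hv, ← integral_inner hint, ← integral_conj]
    refine integral_congr_ae (Filter.Eventually.of_forall fun y => ?_)
    simp only [inner_smul_right, map_mul, Complex.conj_conj, inner_conj_symm]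
    ring

end Wave

/-! ### Integrals of the Wigner function over energy and time -/

open FourierTransform

/-- A composition of two shears with coordinate swaps, hence of determinant one. -/
theorem measurePreserving_midpoint :
    MeasurePreserving (fun p : ℝ × ℝ => (p.1 - p.2 / 2, p.1 + p.2 / 2)) volume volume := by
  have h1 : MeasurePreserving (fun p : ℝ × ℝ => (p.1, p.2 - p.1 / 2)) volume volume := by
    refine MeasurePreserving.skew_product (g := fun x y : ℝ => y - x / 2)
      (MeasurePreserving.id _) (by fun_prop) ?_
    exact Filter.Eventually.of_forall fun x => (measurePreserving_sub_right volume (x / 2)).map_eq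
  have hs : MeasurePreserving (Prod.swap : ℝ × ℝ → ℝ × ℝ) volume volume :=
    Measure.measurePreserving_swap
  have h2 : MeasurePreserving (fun p : ℝ × ℝ => (p.1, p.2 + p.1)) volume volume := by
    refine MeasurePreserving.skew_product (g := fun x y : ℝ => y + x)
      (MeasurePreserving.id _) (by fun_prop) ?_
    exact Filter.Eventually.of_forall fun x => (measurePreserving_add_right volume x).map_eq
  convert h2.comp (hs.comp (h1.comp hs)) using 1
  ext p
  · simp
  · simp; ring

section VectorValued

variable {F : Type*} [NormedAddCommGroup F] [InnerProductSpace ℂ F] [CompleteSpace F]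

theorem norm_cexp_of_eq {z : ℂ} (r : ℝ) (h : z = r * I) : ‖cexp z‖ = 1 := by
  rw [h, norm_exp_ofReal_mul_I]

theorem Integrable.phase_smul {f : ℝ → F} (hf : Integrable f) (a : ℝ) :
    Integrable fun x : ℝ => cexp (I * (a * x : ℝ)) • f x := by
  refine hf.bdd_smul 1 (by fun_prop) (Filter.Eventually.of_forall fun x => ?_)
  rw [norm_cexp_of_eq (a * x) (by ring)]

theorem memLp_phase_smul {f : ℝ → F} (hf : MemLp f 2) (a : ℝ) :
    MemLp (fun x : ℝ => cexp (I * (a * x : ℝ)) • f x) 2 := by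
  refine hf.of_le (AEStronglyMeasurable.smul (by fun_prop) hf.1)
    (Filter.Eventually.of_forall fun x => ?_)
  rw [norm_smul, norm_cexp_of_eq (a * x) (by ring), one_mul]

theorem integral_integral_inner {f g : ℝ → F} (hf : Integrable f) (hg : Integrable g) :
    ∫ x, ∫ y, ⟪f y, g x⟫_ℂ = ⟪∫ y, f y, ∫ x, g x⟫_ℂ := by
  rw [← integral_inner hg]
  refine integral_congr_ae (Filter.Eventually.of_forall fun x => ?_)
  simp only
  rw [← inner_conj_symm, ← integral_inner hf, ← integral_conj]
  simp only [inner_conj_symm]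

/-- In the variables `E ∓ ω/2` the phase `e^{iEs} e^{iωt}` splits into one factor for each argument
of the kernel, with frequencies `t ∓ s/2`. Integrability of `Φ` justifies Fubini. -/
theorem integral_exp_mul_wigner {ρ : Weight →L[ℂ] Weight} {Φ : ℝ → F} (hΦ : Integrable Φ)
    (hK : ∀ᵐ p : ℝ × ℝ, kernel ρ p.1 p.2 = ⟪Φ p.2, Φ p.1⟫_ℂ) (s t : ℝ) :
    ∫ E : ℝ, cexp (I * E * s) * wigner ρ E t =
      1 / (2 * Real.pi) * ⟪∫ x : ℝ, cexp (I * (-(t + s / 2) * x : ℝ)) • Φ x,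
        ∫ x : ℝ, cexp (I * (-(t - s / 2) * x : ℝ)) • Φ x⟫_ℂ := by
  set a := fun x : ℝ => cexp (I * (-(t + s / 2) * x : ℝ)) • Φ x
  set b := fun x : ℝ => cexp (I * (-(t - s / 2) * x : ℝ)) • Φ x
  have ha : Integrable a := Integrable.phase_smul hΦ _
  have hb : Integrable b := Integrable.phase_smul hΦ _
  have hf : Integrable (fun p : ℝ × ℝ => ⟪a p.2, b p.1⟫_ℂ) volume := by
    have hm : AEStronglyMeasurable (fun p : ℝ × ℝ => ⟪a p.2, b p.1⟫_ℂ)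
        ((volume : Measure ℝ).prod volume) := ha.1.comp_snd.inner hb.1.comp_fst
    refine (hb.norm.mul_prod ha.norm).mono' hm (Filter.Eventually.of_forall fun p => ?_)
    rw [mul_comm]
    exact norm_inner_le_norm _ _
  rw [← integral_integral_inner ha hb, ← integral_prod (fun p : ℝ × ℝ => ⟪a p.2, b p.1⟫_ℂ) hf]
  have hmp := measurePreserving_midpoint
  have hf' := (hmp.integrable_comp hf.1).2 hf
  have e1 : ∫ p : ℝ × ℝ, ⟪a p.2, b p.1⟫_ℂ ∂((volume : Measure ℝ).prod volume) =
      ∫ E : ℝ, ∫ ω : ℝ, ⟪a (E + ω / 2), b (E - ω / 2)⟫_ℂ := by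
    rw [← integral_prod (fun p : ℝ × ℝ => ⟪a (p.1 + p.2 / 2), b (p.1 - p.2 / 2)⟫_ℂ) hf']
    have h0 := hf.1
    rw [← hmp.map_eq] at h0
    have := integral_map hmp.measurable.aemeasurable h0
    rw [hmp.map_eq] at this
    exact this
  rw [e1, ← integral_const_mul]
  have hK' : ∀ᵐ p : ℝ × ℝ ∂((volume : Measure ℝ).prod volume),
      kernel ρ (p.1 - p.2 / 2) (p.1 + p.2 / 2) =
        ⟪Φ (p.1 + p.2 / 2), Φ (p.1 - p.2 / 2)⟫_ℂ := hmp.quasiMeasurePreserving.ae hK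
  refine integral_congr_ae ?_
  filter_upwards [Measure.ae_ae_of_ae_prod hK'] with E hE
  rw [wigner, ← mul_assoc, mul_comm (cexp _), mul_assoc, ← integral_const_mul]
  congr 1
  refine integral_congr_ae ?_
  filter_upwards [hE] with ω hω
  simp only [a, b]
  rw [hω, inner_smul_left, inner_smul_right, ← mul_assoc, ← mul_assoc, ← Complex.exp_conj,
    ← Complex.exp_add, ← Complex.exp_add]
  congr 2
  simp only [map_mul, Complex.conj_I, Complex.conj_ofReal]
  push_cast
  ring

theorem fourier_comp_sub (f : ℝ → F) (ω τ : ℝ) :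
    𝓕 (fun x => f (x - ω)) τ = cexp (-(2 * Real.pi * ω * τ) * I) • 𝓕 f τ := by
  rw [Real.fourier_real_eq_integral_exp_smul, Real.fourier_real_eq_integral_exp_smul,
    ← integral_smul, ← integral_sub_right_eq_self (fun v : ℝ =>
      cexp (-(2 * Real.pi * ω * τ) * I) • cexp (↑(-2 * Real.pi * v * τ) * I) • f v) ω]
  refine integral_congr_ae (Filter.Eventually.of_forall fun x => ?_)
  simp only
  rw [smul_smul, ← Complex.exp_add]
  congr 2
  push_cast
  ring

/-- The Fourier transform in `t` of the cross-correlation of two frequencies. -/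
theorem integral_inner_phase {Φ : ℝ → F} (hΦ : Integrable Φ) (hΦ2 : MemLp Φ 2) (s ω : ℝ) :
    ∫ t : ℝ, 1 / (2 * Real.pi) * ⟪∫ x : ℝ, cexp (I * (-(t + s / 2) * x : ℝ)) • Φ x,
        ∫ x : ℝ, cexp (I * (-(t - s / 2) * x : ℝ)) • Φ x⟫_ℂ * cexp (-(I * t * ω)) =
      cexp (-(I * ω * s / 2)) * ∫ x : ℝ, cexp (I * x * s) * ⟪Φ x, Φ (x - ω)⟫_ℂ := by
  set f := fun x : ℝ => cexp (I * (-(s / 2) * x : ℝ)) • Φ x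
  set g := fun x : ℝ => cexp (I * (s / 2 * x : ℝ)) • Φ x
  have hf : Integrable f := Integrable.phase_smul hΦ _
  have hg : Integrable g := Integrable.phase_smul hΦ _
  have hf2 : MemLp f 2 := memLp_phase_smul hΦ2 _
  have hg2 : MemLp g 2 := memLp_phase_smul hΦ2 _
  -- Translating `g` by `ω` produces the factor `e^{-iωt}` on the Fourier side, so one use of
  -- Plancherel evaluates the whole `t`-integral.
  have h := integral_inner_fourier_fourier hf hf2 (hg.comp_sub_right ω)
    (hg2.comp_measurePreserving (measurePreserving_sub_right volume ω))
  set G : ℝ → ℂ := fun t => 1 / (2 * Real.pi) *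
    ⟪∫ x : ℝ, cexp (I * (-(t + s / 2) * x : ℝ)) • Φ x,
        ∫ x : ℝ, cexp (I * (-(t - s / 2) * x : ℝ)) • Φ x⟫_ℂ * cexp (-(I * t * ω))
  have hpi : (0 : ℝ) < 2 * Real.pi := by positivity
  -- The substitution `t = 2πτ` absorbs the `2π` in the Fourier convention and cancels the prefactor
  -- of the Wigner function.
  have hG : ∀ τ : ℝ, ⟪𝓕 f τ, 𝓕 (fun x => g (x - ω)) τ⟫_ℂ = (2 * Real.pi : ℝ) • G (2 * Real.pi * τ) := by
    intro τ
    rw [fourier_comp_sub, Real.fourier_real_eq_integral_exp_smul,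
      Real.fourier_real_eq_integral_exp_smul, inner_smul_right]
    have e1 : ∫ v : ℝ, cexp (↑(-2 * Real.pi * v * τ) * I) • f v =
        ∫ x : ℝ, cexp (I * (-(2 * Real.pi * τ + s / 2) * x : ℝ)) • Φ x := by
      refine integral_congr_ae (Filter.Eventually.of_forall fun x => ?_)
      simp only [f]
      rw [smul_smul, ← Complex.exp_add]
      congr 2
      push_cast
      ring
    have e2 : ∫ v : ℝ, cexp (↑(-2 * Real.pi * v * τ) * I) • g v =
        ∫ x : ℝ, cexp (I * (-(2 * Real.pi * τ - s / 2) * x : ℝ)) • Φ x := by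
      refine integral_congr_ae (Filter.Eventually.of_forall fun x => ?_)
      simp only [g]
      rw [smul_smul, ← Complex.exp_add]
      congr 2
      push_cast
      ring
    rw [e1, e2]
    simp only [G, Complex.real_smul]
    rw [show cexp (-(I * ((2 * Real.pi * τ : ℝ) : ℂ) * ω)) = cexp (-(2 * Real.pi * ω * τ) * I) by
      congr 1; push_cast; ring]
    have : (Real.pi : ℂ) ≠ 0 := by exact_mod_cast Real.pi_ne_zero
    push_cast
    field_simp
  have hsub : ∫ t, G t = ∫ τ : ℝ, (2 * Real.pi : ℝ) • G (2 * Real.pi * τ) := by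
    rw [integral_smul, Measure.integral_comp_mul_left, abs_of_pos (inv_pos.2 hpi), smul_smul,
      mul_inv_cancel₀ hpi.ne', one_smul]
  rw [hsub, ← integral_congr_ae (Filter.Eventually.of_forall hG), h, ← integral_const_mul]
  refine integral_congr_ae (Filter.Eventually.of_forall fun x => ?_)
  simp only [f, g]
  rw [inner_smul_left, inner_smul_right, ← mul_assoc, ← mul_assoc, ← Complex.exp_conj,
    ← Complex.exp_add, ← Complex.exp_add]
  congr 2
  simp only [map_mul, Complex.conj_I, Complex.conj_ofReal]
  push_cast
  ring

end VectorValued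

/-! ### The characteristic function and a closed form of `ξ_S` -/

section Xi

/-- `Tr[e^{i H_W s} e^{-i Δ_W ω} ρ_W]`. -/
def charFn (ρ : Weight →L[ℂ] Weight) (ω s : ℝ) : ℂ :=
  trace ((expWeightHamiltonian s ∘L displacement ω) ∘L ρ)

variable {ρ : Weight →L[ℂ] Weight}

theorem xiDenominator_eq (s : ℝ) : xiDenominator ρ s = charFn ρ 0 s := by
  rw [xiDenominator, charFn, displacement_zero, ContinuousLinearMap.comp_id]

theorem charFn_eq_integral (hρ : IsDensityOperator ρ) (ω s : ℝ) :
    charFn ρ ω s = ∫ x : ℝ, cexp (I * x * s) *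
      ⟪wave (sqrtOp ρ) x, wave (sqrtOp ρ) (x - ω)⟫_ℂ := by
  have hT := hρ.isHilbertSchmidt_sqrt
  rw [charFn, hρ.trace_comp_self, ContinuousLinearMap.comp_assoc,
    ← inner_wave hT ((hT.comp_left _).comp_left _), L2.inner_def]
  refine integral_congr_ae ?_
  filter_upwards [wave_exp_ae (hT.comp_left (displacement ω)) s, wave_displacement_ae hT ω]
    with x h1 h2
  rw [h1, h2, inner_smul_right]

theorem isKernel_kernel (hρ : IsDensityOperator ρ) : IsKernel ρ (kernel ρ) :=
  Classical.epsilon_spec ⟨_, isKernel_wave hρ.isHilbertSchmidt_sqrt (adjoint_sqrt ρ)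
    hρ.isPositive.sqrt_comp_sqrt⟩

variable {ι : Type*} [Fintype ι] [DecidableEq ι]

theorem freeEvolution_apply (ε : ι → ℝ) (ρS : Matrix ι ι ℂ) (t : ℝ) (i j : ι) :
    freeEvolution ε ρS t i j = cexp (-(I * t * (ε i - ε j : ℝ))) * ρS i j := by
  rw [freeEvolution, systemHamiltonian, ← Matrix.diagonal_smul, ← Matrix.diagonal_smul,
    Matrix.exp_diagonal, Matrix.exp_diagonal, Matrix.mul_diagonal, Matrix.diagonal_mul,
    Pi.coe_exp, Pi.coe_exp]
  simp only [Pi.smul_apply, smul_eq_mul, ← Complex.exp_eq_exp_ℂ]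
  rw [mul_right_comm, ← Complex.exp_add]
  congr 2
  push_cast
  ring

/-- Free evolution multiplies the `(i, j)` entry by `e^{-it(ε i - ε j)}`, so the `t`-integral is a
Fourier transform of the Wigner function at the Bohr frequency `ε i - ε j`. -/
theorem xi_apply (hρ : IsDensityOperator ρ) (hE : HasFiniteSecondMoment weightHamiltonian ρ)
    (ε : ι → ℝ) (ρS : Matrix ι ι ℂ) (s : ℝ) (i j : ι) :
    xi ε ρS ρ s i j = ρS i j *
      (cexp (-(I * (ε i - ε j : ℝ) * s / 2)) * charFn ρ (ε i - ε j) s) / charFn ρ 0 s := by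
  obtain ⟨Y, hY, hg⟩ := exists_weightHamiltonian_comp_sqrt hE
  have hT := hρ.isHilbertSchmidt_sqrt
  have hK := (isKernel_kernel hρ).ae_eq (isKernel_wave hT (adjoint_sqrt ρ)
    hρ.isPositive.sqrt_comp_sqrt)
  rw [xi, Matrix.of_apply, xiDenominator_eq, charFn_eq_integral hρ (ε i - ε j),
    ← integral_inner_phase (integrable_wave hT hY hg) (Lp.memLp _), ← integral_const_mul]
  congr 1
  refine integral_congr_ae (Filter.Eventually.of_forall fun t => ?_)
  simp only
  rw [integral_exp_mul_wigner (integrable_wave hT hY hg) hK, freeEvolution_apply]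
  ring

end Xi

/-! ### Block calculus on the composite space and square roots of the joint states -/

section Joint

variable {ι : Type*} [Fintype ι] [DecidableEq ι]

theorem comp_apply (i : ι) (Ψ : Joint ι) : comp i Ψ = Ψ i := rfl

theorem incl_apply (j i : ι) (ψ : Weight) : incl j ψ i = if i = j then ψ else 0 := by
  change (Pi.single j ψ : ι → Weight) i = _
  rw [Pi.single_apply]

theorem comp_comp_incl (i j : ι) :
    comp i ∘L incl j = if i = j then ContinuousLinearMap.id ℂ Weight else 0 := by
  ext1 ψ
  rw [ContinuousLinearMap.comp_apply, comp_apply, incl_apply]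
  split_ifs <;> rfl

theorem adjoint_incl (j : ι) : ContinuousLinearMap.adjoint (incl j) = comp j := by
  refine ContinuousLinearMap.ext fun Ψ => ext_inner_left ℂ fun ψ => ?_
  rw [ContinuousLinearMap.adjoint_inner_right, PiLp.inner_apply,
    Finset.sum_eq_single j (fun i _ hi => by rw [incl_apply, if_neg hi, inner_zero_left])
      (by simp), incl_apply, if_pos rfl, comp_apply]

theorem adjoint_comp' (j : ι) : ContinuousLinearMap.adjoint (comp j) = incl j := by
  rw [← adjoint_incl, ContinuousLinearMap.adjoint_adjoint]

theorem sum_incl_comp : ∑ j : ι, incl j ∘L comp j = ContinuousLinearMap.id ℂ (Joint ι) := by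
  ext1 Ψ
  ext1 i
  rw [sum_apply, WithLp.ofLp_sum, Finset.sum_apply,
    Finset.sum_eq_single i (fun j _ hj => by
      rw [ContinuousLinearMap.comp_apply, incl_apply, if_neg hj.symm]) (by simp),
    ContinuousLinearMap.comp_apply, incl_apply, if_pos rfl]
  rfl

theorem comp_tensorOp (A : Matrix ι ι ℂ) (B : Weight →L[ℂ] Weight) (i : ι) :
    comp i ∘L tensorOp A B = ∑ j, A i j • (B ∘L comp j) := by
  rw [tensorOp, ContinuousLinearMap.comp_finsetSum, Finset.sum_eq_single i _ (by simp)]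
  · rw [ContinuousLinearMap.comp_finsetSum]
    refine Finset.sum_congr rfl fun j _ => ?_
    rw [ContinuousLinearMap.comp_smul, ← ContinuousLinearMap.comp_assoc, comp_comp_incl,
      if_pos rfl, ContinuousLinearMap.id_comp]
  · intro k _ hk
    rw [ContinuousLinearMap.comp_finsetSum]
    refine Finset.sum_eq_zero fun j _ => ?_
    rw [ContinuousLinearMap.comp_smul, ← ContinuousLinearMap.comp_assoc, comp_comp_incl,
      if_neg hk.symm, ContinuousLinearMap.zero_comp, smul_zero]

theorem tensorOp_apply (A : Matrix ι ι ℂ) (B : Weight →L[ℂ] Weight) (Ψ : Joint ι) (i : ι) :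
    tensorOp A B Ψ i = ∑ j, A i j • B (Ψ j) := by
  have := congrArg (fun X : Joint ι →L[ℂ] Weight => X Ψ) (comp_tensorOp A B i)
  simpa only [ContinuousLinearMap.comp_apply, comp_apply, sum_apply, smul_apply] using this

theorem tensorOp_comp (A C : Matrix ι ι ℂ) (B D : Weight →L[ℂ] Weight) :
    tensorOp A B ∘L tensorOp C D = tensorOp (A * C) (B ∘L D) := by
  ext1 Ψ
  ext1 i
  simp only [ContinuousLinearMap.comp_apply, tensorOp_apply, map_sum, map_smul, Matrix.mul_apply,
    Finset.sum_smul, Finset.smul_sum, smul_smul]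
  exact Finset.sum_comm

theorem adjoint_tensorOp (A : Matrix ι ι ℂ) (B : Weight →L[ℂ] Weight) :
    ContinuousLinearMap.adjoint (tensorOp A B) =
      tensorOp A.conjTranspose (ContinuousLinearMap.adjoint B) := by
  simp only [tensorOp, map_sum, map_smulₛₗ, ContinuousLinearMap.adjoint_comp, adjoint_incl,
    adjoint_comp', ContinuousLinearMap.comp_assoc]
  rw [Finset.sum_comm]
  simp only [Matrix.conjTranspose_apply]
  rfl

theorem jointSystemOp_apply (A : Matrix ι ι ℂ) (Ψ : Joint ι) (i : ι) :
    jointSystemOp A Ψ i = ∑ j, A i j • Ψ j := by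
  simp only [jointSystemOp, tensorOp_apply, ContinuousLinearMap.id_apply]

theorem jointSystemOp_comp (A B : Matrix ι ι ℂ) :
    jointSystemOp A ∘L jointSystemOp B = jointSystemOp (A * B) := by
  simp only [jointSystemOp, tensorOp_comp, ContinuousLinearMap.id_comp]

theorem jointSystemOp_one :
    jointSystemOp (1 : Matrix ι ι ℂ) = ContinuousLinearMap.id ℂ (Joint ι) := by
  ext1 Ψ
  ext1 i
  simp [jointSystemOp_apply, Matrix.one_apply]

theorem jointSystemOp_sub (A B : Matrix ι ι ℂ) :
    jointSystemOp (A - B) = jointSystemOp A - jointSystemOp B := by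
  ext1 Ψ
  ext1 i
  simp [jointSystemOp_apply, sub_smul]

theorem adjoint_jointSystemOp (A : Matrix ι ι ℂ) :
    ContinuousLinearMap.adjoint (jointSystemOp A) = jointSystemOp A.conjTranspose := by
  simp only [jointSystemOp, adjoint_tensorOp, ContinuousLinearMap.adjoint_id]

theorem jointSystemOp_systemHamiltonian_apply (ε : ι → ℝ) (Ψ : Joint ι) (i : ι) :
    jointSystemOp (systemHamiltonian ε) Ψ i = (ε i : ℂ) • Ψ i := by
  rw [jointSystemOp_apply, Finset.sum_eq_single i (fun j _ hj => by
    rw [systemHamiltonian, Matrix.diagonal_apply_ne _ hj.symm, zero_smul]) (by simp),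
    systemHamiltonian, Matrix.diagonal_apply_eq]

theorem shiftOp_apply (ε : ι → ℝ) (Ψ : Joint ι) (i : ι) :
    shiftOp ε Ψ i = displacement (ε i) (Ψ i) := by
  rw [shiftOp, sum_apply, WithLp.ofLp_sum, Finset.sum_apply, Finset.sum_eq_single i _ (by simp)]
  · rw [tensorOp_apply, Finset.sum_eq_single i _ (by simp)]
    · simp
    · intro j _ hj
      simp [hj.symm]
  · intro j _ hj
    rw [tensorOp_apply]
    simp [hj]

theorem comp_shiftOp (ε : ι → ℝ) (i : ι) :
    comp i ∘L shiftOp ε = displacement (ε i) ∘L comp i :=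
  ContinuousLinearMap.ext fun Ψ => shiftOp_apply ε Ψ i

theorem adjoint_shiftOp (ε : ι → ℝ) :
    ContinuousLinearMap.adjoint (shiftOp ε) = shiftOp (-ε) := by
  refine ContinuousLinearMap.ext fun Ψ => ext_inner_left ℂ fun Θ => ?_
  rw [ContinuousLinearMap.adjoint_inner_right, PiLp.inner_apply, PiLp.inner_apply]
  refine Finset.sum_congr rfl fun i _ => ?_
  rw [shiftOp_apply, shiftOp_apply, Pi.neg_apply, ← adjoint_displacement,
    ContinuousLinearMap.adjoint_inner_right]

theorem shiftOp_neg_comp (ε : ι → ℝ) :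
    shiftOp (-ε) ∘L shiftOp ε = ContinuousLinearMap.id ℂ (Joint ι) := by
  ext1 Ψ
  ext1 i
  rw [ContinuousLinearMap.comp_apply, shiftOp_apply, shiftOp_apply,
    ← ContinuousLinearMap.comp_apply, displacement_comp, Pi.neg_apply, neg_add_cancel,
    displacement_zero]
  rfl

theorem adjoint_shiftOp_comp (ε : ι → ℝ) :
    ContinuousLinearMap.adjoint (shiftOp ε) ∘L shiftOp ε = ContinuousLinearMap.id ℂ (Joint ι) := by
  rw [adjoint_shiftOp, shiftOp_neg_comp]

theorem shiftOp_comp_adjoint (ε : ι → ℝ) :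
    shiftOp ε ∘L ContinuousLinearMap.adjoint (shiftOp ε) = ContinuousLinearMap.id ℂ (Joint ι) := by
  have := shiftOp_neg_comp (-ε)
  rwa [neg_neg, ← adjoint_shiftOp] at this

theorem mem_graph_joint {Ψ Θ : Joint ι} :
    (Ψ, Θ) ∈ (jointWeightHamiltonian : Joint ι →ₗ.[ℂ] Joint ι).graph ↔
      ∀ i, (Ψ i, Θ i) ∈ weightHamiltonian.graph := by
  rw [LinearPMap.mem_graph_iff]
  constructor
  · rintro ⟨z, rfl, rfl⟩ i
    exact LinearPMap.mem_graph weightHamiltonian ⟨(z : Joint ι) i, z.2 i⟩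
  · intro h
    have hd : ∀ i, Ψ i ∈ weightHamiltonian.domain := fun i => (mem_graph_iff_app.1 (h i)).1
    refine ⟨⟨Ψ, hd⟩, rfl, ?_⟩
    ext1 i
    obtain ⟨z, hz, hz'⟩ := (LinearPMap.mem_graph_iff _).1 (h i)
    change weightHamiltonian ⟨Ψ i, hd i⟩ = Θ i
    simp only at hz hz'
    rw [← hz']
    congr 1
    exact Subtype.ext hz.symm

theorem mem_graph_tensorOp {T Y : Weight →L[ℂ] Weight}
    (h : ∀ ψ, (T ψ, Y ψ) ∈ weightHamiltonian.graph) (A : Matrix ι ι ℂ) (Ψ : Joint ι) :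
    (tensorOp A T Ψ, tensorOp A Y Ψ) ∈ jointWeightHamiltonian.graph := by
  rw [mem_graph_joint]
  intro i
  rw [tensorOp_apply, tensorOp_apply]
  have := Submodule.sum_mem weightHamiltonian.graph (t := Finset.univ)
    (f := fun j => A i j • (T (Ψ j), Y (Ψ j))) fun j _ => Submodule.smul_mem _ _ (h _)
  convert this using 1
  ext1
  · simp [Prod.fst_sum]
  · simp [Prod.snd_sum]

theorem mem_graph_jointSystemOp {Ψ Θ : Joint ι} (h : (Ψ, Θ) ∈ jointWeightHamiltonian.graph)
    (A : Matrix ι ι ℂ) :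
    (jointSystemOp A Ψ, jointSystemOp A Θ) ∈ jointWeightHamiltonian.graph := by
  rw [mem_graph_joint] at *
  intro i
  rw [jointSystemOp_apply, jointSystemOp_apply]
  have := Submodule.sum_mem weightHamiltonian.graph (t := Finset.univ)
    (f := fun j => A i j • (Ψ j, Θ j)) fun j _ => Submodule.smul_mem _ _ (h _)
  convert this using 1
  ext1
  · simp [Prod.fst_sum]
  · simp [Prod.snd_sum]

theorem mem_graph_shiftOp {Ψ Θ : Joint ι} (h : (Ψ, Θ) ∈ jointWeightHamiltonian.graph)
    (ε : ι → ℝ) :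
    (shiftOp ε Ψ, shiftOp ε (Θ + jointSystemOp (systemHamiltonian ε) Ψ)) ∈
      jointWeightHamiltonian.graph := by
  rw [mem_graph_joint] at *
  intro i
  rw [shiftOp_apply, shiftOp_apply, PiLp.add_apply, jointSystemOp_systemHamiltonian_apply]
  exact mem_graph_displacement (h i) _

theorem mem_graph_adjoint_shiftOp {Ψ Θ : Joint ι} (h : (Ψ, Θ) ∈ jointWeightHamiltonian.graph)
    (ε : ι → ℝ) :
    (ContinuousLinearMap.adjoint (shiftOp ε) Ψ, ContinuousLinearMap.adjoint (shiftOp ε)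
      (Θ - jointSystemOp (systemHamiltonian ε) Ψ)) ∈ jointWeightHamiltonian.graph := by
  have h1 := mem_graph_shiftOp h (-ε)
  rw [adjoint_shiftOp]
  convert h1 using 4
  ext1 i
  rw [PiLp.sub_apply, PiLp.add_apply, jointSystemOp_systemHamiltonian_apply,
    jointSystemOp_systemHamiltonian_apply]
  simp [sub_eq_add_neg]

theorem IsHilbertSchmidt.tensorOp {B : Weight →L[ℂ] Weight} (hB : IsHilbertSchmidt B)
    (A : Matrix ι ι ℂ) : IsHilbertSchmidt (tensorOp A B) :=
  IsHilbertSchmidt.sum fun i _ => IsHilbertSchmidt.sum fun j _ =>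
    ((hB.comp_right (comp j)).comp_left (incl i)).smul _

/-- The chosen Hilbert basis of the composite space need not be adapted to the blocks. Instead the
identity `∑ incl j ∘ comp j` is inserted on each side and moved across by cyclicity. -/
theorem hsInner_joint {X Y : Joint ι →L[ℂ] Joint ι} (hX : IsHilbertSchmidt X)
    (hY : IsHilbertSchmidt Y) :
    hsInner X Y = ∑ i, ∑ j, hsInner (comp i ∘L X ∘L incl j) (comp i ∘L Y ∘L incl j) := by
  have h1 : Y = ∑ j, (Y ∘L incl j) ∘L ContinuousLinearMap.adjoint (incl j) := by
    simp only [adjoint_incl, ContinuousLinearMap.comp_assoc]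
    rw [← ContinuousLinearMap.comp_finsetSum, sum_incl_comp, ContinuousLinearMap.comp_id]
  conv_lhs => rw [h1]
  rw [hsInner_sum_right _ hX fun j => (hY.comp_right _).comp_right _, Finset.sum_comm]
  refine Finset.sum_congr rfl fun j _ => ?_
  rw [hsInner_comp_right hX (hY.comp_right _)]
  have h2 : Y ∘L incl j = ∑ i, ContinuousLinearMap.adjoint (comp i) ∘L comp i ∘L Y ∘L incl j := by
    simp only [adjoint_comp', ← ContinuousLinearMap.comp_assoc]
    rw [← ContinuousLinearMap.finsetSum_comp, ← ContinuousLinearMap.finsetSum_comp, sum_incl_comp,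
      ContinuousLinearMap.id_comp]
  conv_lhs => rw [h2]
  rw [hsInner_sum_right _ (hX.comp_right _) fun i =>
    (((hY.comp_right _).comp_left _).comp_left _)]
  refine Finset.sum_congr rfl fun i _ => ?_
  rw [← hsInner_comp_left]

theorem exists_posSemidef_sqrt {A : Matrix ι ι ℂ} (hA : A.PosSemidef) :
    ∃ B : Matrix ι ι ℂ, B.PosSemidef ∧ B * B = A := by
  open scoped MatrixOrder Matrix.Norms.L2Operator in
  exact ⟨CFC.sqrt A, Matrix.nonneg_iff_posSemidef.1 (CFC.sqrt_nonneg A),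
    CFC.sqrt_mul_sqrt_self A (Matrix.nonneg_iff_posSemidef.2 hA)⟩

/-- Factoring `A = C²` and `B = T²` exhibits `A ⊗ B` as `X†X` with `X = C ⊗ T`. -/
theorem isPositive_tensorOp {A : Matrix ι ι ℂ} {B : Weight →L[ℂ] Weight} (hA : A.PosSemidef)
    (hB : B.IsPositive) : (tensorOp A B).IsPositive := by
  obtain ⟨C, hC, rfl⟩ := exists_posSemidef_sqrt hA
  rw [← hB.sqrt_comp_sqrt, ← tensorOp_comp]
  have h : ContinuousLinearMap.adjoint (tensorOp C (sqrtOp B)) = tensorOp C (sqrtOp B) := by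
    rw [adjoint_tensorOp, hC.1.eq, adjoint_sqrt]
  nth_rw 1 [← h]
  exact ContinuousLinearMap.isPositive_adjoint_comp_self _

theorem sqrtOp_tensorOp {A : Matrix ι ι ℂ} {B : Weight →L[ℂ] Weight} (hA : A.PosSemidef)
    (hB : B.IsPositive) :
    sqrtOp (tensorOp (A * A) B) = tensorOp A (sqrtOp B) :=
  sqrtOp_eq (by rw [tensorOp_comp, hB.sqrt_comp_sqrt])
    (isPositive_tensorOp hA (isPositive_sqrt B))

theorem sqrtOp_controlState (ε : ι → ℝ) {A : Matrix ι ι ℂ} {B : Weight →L[ℂ] Weight}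
    (hA : A.PosSemidef) (hB : B.IsPositive) :
    sqrtOp (controlState ε (A * A) B) = shiftOp ε ∘L tensorOp A (sqrtOp B) ∘L
      ContinuousLinearMap.adjoint (shiftOp ε) := by
  refine sqrtOp_eq ?_ ((isPositive_tensorOp hA (isPositive_sqrt B)).conj_adjoint _)
  have h : tensorOp (A * A) B = tensorOp A (sqrtOp B) ∘L tensorOp A (sqrtOp B) := by
    rw [tensorOp_comp, hB.sqrt_comp_sqrt]
  rw [controlState, h]
  simp only [ContinuousLinearMap.comp_assoc]
  congr 2
  rw [← ContinuousLinearMap.comp_assoc, ← ContinuousLinearMap.comp_assoc, adjoint_shiftOp_comp,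
    ContinuousLinearMap.id_comp]

end Joint

/-! ### Amplitudes of the control state and the first-order condition -/

section Amplitudes

variable {ι : Type*} [Fintype ι] [DecidableEq ι]

/-- `S √ρ` for `√ρ = s ⊗ T`. -/
def controlAmp (ε : ι → ℝ) (s : Matrix ι ι ℂ) (T : Weight →L[ℂ] Weight) :
    Joint ι →L[ℂ] Joint ι :=
  shiftOp ε ∘L tensorOp s T

/-- `H_W S √ρ = S (H_W + H_S) √ρ` for `√ρ = s ⊗ T`, `H_W T = Y`. -/
def weightAmp (ε : ι → ℝ) (s : Matrix ι ι ℂ) (T Y : Weight →L[ℂ] Weight) :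
    Joint ι →L[ℂ] Joint ι :=
  shiftOp ε ∘L (tensorOp s Y + jointSystemOp (systemHamiltonian ε) ∘L tensorOp s T)

variable {ε : ι → ℝ} {s : Matrix ι ι ℂ} {T Y : Weight →L[ℂ] Weight}

theorem isHilbertSchmidt_controlAmp (hT : IsHilbertSchmidt T) :
    IsHilbertSchmidt (controlAmp ε s T) :=
  (hT.tensorOp s).comp_left _

theorem isHilbertSchmidt_weightAmp (hT : IsHilbertSchmidt T) (hY : IsHilbertSchmidt Y) :
    IsHilbertSchmidt (weightAmp ε s T Y) :=
  ((hY.tensorOp s).add ((hT.tensorOp s).comp_left _)).comp_left _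

theorem tensorOp_comp_incl (A : Matrix ι ι ℂ) (B : Weight →L[ℂ] Weight) (i j : ι) :
    comp i ∘L tensorOp A B ∘L incl j = A i j • B := by
  rw [← ContinuousLinearMap.comp_assoc, comp_tensorOp, ContinuousLinearMap.finsetSum_comp,
    Finset.sum_eq_single j _ (by simp)]
  · rw [ContinuousLinearMap.smul_comp, ContinuousLinearMap.comp_assoc, comp_comp_incl, if_pos rfl,
      ContinuousLinearMap.comp_id]
  · intro k _ hk
    rw [ContinuousLinearMap.smul_comp, ContinuousLinearMap.comp_assoc, comp_comp_incl, if_neg hk,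
      ContinuousLinearMap.comp_zero, smul_zero]

theorem comp_systemOp (A : Matrix ι ι ℂ) (i : ι) :
    comp i ∘L jointSystemOp A = ∑ l, A i l • comp l := by
  simp only [jointSystemOp, comp_tensorOp, ContinuousLinearMap.id_comp]

theorem comp_systemHamiltonian (ε : ι → ℝ) (i : ι) :
    comp i ∘L jointSystemOp (systemHamiltonian ε) = (ε i : ℂ) • comp i :=
  ContinuousLinearMap.ext fun Ψ => jointSystemOp_systemHamiltonian_apply ε Ψ i

theorem controlAmp_component (i j : ι) :
    comp i ∘L controlAmp ε s T ∘L incl j = s i j • (displacement (ε i) ∘L T) := by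
  rw [controlAmp, ContinuousLinearMap.comp_assoc, ← ContinuousLinearMap.comp_assoc, comp_shiftOp,
    ContinuousLinearMap.comp_assoc, tensorOp_comp_incl, ContinuousLinearMap.comp_smul]

theorem weightAmp_component (i j : ι) :
    comp i ∘L weightAmp ε s T Y ∘L incl j =
      s i j • (displacement (ε i) ∘L (Y + (ε i : ℂ) • T)) := by
  have h : comp i ∘L (tensorOp s Y + jointSystemOp (systemHamiltonian ε) ∘L tensorOp s T) ∘L
      incl j = s i j • (Y + (ε i : ℂ) • T) := by
    rw [ContinuousLinearMap.add_comp, ContinuousLinearMap.comp_add, tensorOp_comp_incl,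
      ContinuousLinearMap.comp_assoc, ← ContinuousLinearMap.comp_assoc, comp_systemHamiltonian,
      ContinuousLinearMap.smul_comp, tensorOp_comp_incl, smul_add, smul_comm]
  rw [weightAmp, ContinuousLinearMap.comp_assoc, ← ContinuousLinearMap.comp_assoc, comp_shiftOp,
    ContinuousLinearMap.comp_assoc, h, ContinuousLinearMap.comp_smul]

/-- The components factor as `s i j` times an operator depending only on `i`, so summing over `j`
rebuilds the entries of `ρS = s * s`. -/
theorem hsInner_systemOp_of_component (hs : s.IsHermitian) {X Z : Joint ι →L[ℂ] Joint ι}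
    {x z : ι → Weight →L[ℂ] Weight} (hX : IsHilbertSchmidt X) (hZ : IsHilbertSchmidt Z)
    (hz : ∀ i, IsHilbertSchmidt (z i))
    (hXx : ∀ i j, comp i ∘L X ∘L incl j = s i j • x i)
    (hZz : ∀ i j, comp i ∘L Z ∘L incl j = s i j • z i) (hx : ∀ i, IsHilbertSchmidt (x i))
    (A : Matrix ι ι ℂ) :
    hsInner X (jointSystemOp A ∘L Z) =
      ∑ i, ∑ l, A i l * ((s * s) l i * hsInner (x i) (z l)) := by
  have h : ∀ i j, comp i ∘L (jointSystemOp A ∘L Z) ∘L incl j =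
      ∑ l, A i l • s l j • z l := by
    intro i j
    rw [ContinuousLinearMap.comp_assoc, ← ContinuousLinearMap.comp_assoc, comp_systemOp,
      ContinuousLinearMap.finsetSum_comp]
    simp only [ContinuousLinearMap.smul_comp, hZz]
  rw [hsInner_joint hX (hZ.comp_left _)]
  refine Finset.sum_congr rfl fun i _ => ?_
  simp only [h, hXx]
  have h2 : ∀ j, hsInner (s i j • x i) (∑ l, A i l • s l j • z l) =
      ∑ l, A i l * (s l j * s j i * hsInner (x i) (z l)) := by
    intro j
    rw [hsInner_sum_right _ ((hx i).smul _) fun l => ((hz l).smul _).smul _]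
    refine Finset.sum_congr rfl fun l _ => ?_
    rw [hsInner_smul_left, hsInner_smul_right, hsInner_smul_right, ← hs.apply j i,
      starRingEnd_apply]
    ring
  simp only [h2]
  rw [Finset.sum_comm]
  refine Finset.sum_congr rfl fun l _ => ?_
  rw [← Finset.mul_sum, ← Finset.sum_mul, Matrix.mul_apply]

theorem controlMarginal_apply {ρ : Weight →L[ℂ] Weight} (hρ : IsDensityOperator ρ)
    (ρS : Matrix ι ι ℂ) (i j : ι) :
    controlMarginal ε ρS ρ i j = ρS i j *
      hsInner (displacement (ε j) ∘L sqrtOp ρ) (displacement (ε i) ∘L sqrtOp ρ) := by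
  have hT := hρ.isHilbertSchmidt_sqrt
  have h : comp i ∘L controlState ε ρS ρ ∘L incl j = ρS i j • ((displacement (ε i) ∘L sqrtOp ρ) ∘L
      ContinuousLinearMap.adjoint (displacement (ε j) ∘L sqrtOp ρ)) := by
    have e : ContinuousLinearMap.adjoint (shiftOp ε) ∘L incl j =
        incl j ∘L ContinuousLinearMap.adjoint (displacement (ε j)) := by
      rw [← adjoint_comp', ← ContinuousLinearMap.adjoint_comp, comp_shiftOp,
        ContinuousLinearMap.adjoint_comp]
    calc comp i ∘L controlState ε ρS ρ ∘L incl j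
        = (comp i ∘L shiftOp ε) ∘L tensorOp ρS ρ ∘L
          (ContinuousLinearMap.adjoint (shiftOp ε) ∘L incl j) := by
            simp only [controlState, ContinuousLinearMap.comp_assoc]
      _ = displacement (ε i) ∘L (comp i ∘L tensorOp ρS ρ ∘L incl j) ∘L
          ContinuousLinearMap.adjoint (displacement (ε j)) := by
            rw [e, comp_shiftOp]
            simp only [ContinuousLinearMap.comp_assoc]
      _ = _ := by
            rw [tensorOp_comp_incl, ContinuousLinearMap.smul_comp, ContinuousLinearMap.comp_smul,
              ContinuousLinearMap.adjoint_comp, adjoint_sqrt]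
            conv_lhs => rw [← hρ.isPositive.sqrt_comp_sqrt]
            simp only [ContinuousLinearMap.comp_assoc]
  rw [controlMarginal, partialTraceW, Matrix.of_apply, h, trace]
  simp only [smul_apply, inner_smul_right, tsum_mul_left]
  congr 1
  change trace _ = _
  rw [trace_comp, ← hsInner_adjoint (hT.comp_left _) (hT.comp_left _)]

theorem expWeightHamiltonian_zero :
    expWeightHamiltonian 0 = ContinuousLinearMap.id ℂ Weight := by
  ext1 ψ
  apply Lp.ext
  filter_upwards [expWeightHamiltonian_apply_ae 0 ψ] with x hx
  rw [hx]
  simp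

theorem hsInner_displacement {X Z : Weight →L[ℂ] Weight} (a b : ℝ) :
    hsInner (displacement a ∘L X) (displacement b ∘L Z) =
      hsInner X (displacement (b - a) ∘L Z) := by
  rw [hsInner_comp_left, adjoint_displacement, ← ContinuousLinearMap.comp_assoc,
    displacement_comp, neg_add_eq_sub]

theorem charFn_zero_right {ρ : Weight →L[ℂ] Weight} (hρ : IsDensityOperator ρ) (ω : ℝ) :
    charFn ρ ω 0 = hsInner (sqrtOp ρ) (displacement ω ∘L sqrtOp ρ) := by
  rw [charFn, hρ.trace_comp_self, expWeightHamiltonian_zero, ContinuousLinearMap.id_comp]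

theorem charFn_zero_zero {ρ : Weight →L[ℂ] Weight} (hρ : IsDensityOperator ρ) :
    charFn ρ 0 0 = 1 := by
  rw [charFn_zero_right hρ, displacement_zero, ContinuousLinearMap.id_comp, hρ.hsInner_sqrt]

theorem controlMarginal_eq_charFn {ρ : Weight →L[ℂ] Weight} (hρ : IsDensityOperator ρ)
    (ρS : Matrix ι ι ℂ) (i j : ι) :
    controlMarginal ε ρS ρ i j = ρS i j * charFn ρ (ε i - ε j) 0 := by
  rw [controlMarginal_apply hρ, hsInner_displacement, charFn_zero_right hρ]

open FourierTransform in
-- As a function of `s` this is the Fourier transform of `G(x) = ⟨Φ(x), Φ(x - ω)⟩`. Both `G` and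
-- `xG` are integrable, being pointwise inner products of `L²` functions, so differentiation under
-- the integral is allowed.
theorem hasDerivAt_charFn {ρ Y : Weight →L[ℂ] Weight} (hρ : IsDensityOperator ρ)
    (hY : IsHilbertSchmidt Y) (hg : ∀ ψ, (sqrtOp ρ ψ, Y ψ) ∈ weightHamiltonian.graph) (ω : ℝ) :
    HasDerivAt (charFn ρ ω) (I * hsInner Y (displacement ω ∘L sqrtOp ρ)) 0 := by
  have hT := hρ.isHilbertSchmidt_sqrt
  set G : ℝ → ℂ := fun x => ⟪wave (sqrtOp ρ) x, wave (displacement ω ∘L sqrtOp ρ) x⟫_ℂ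
  have hG : Integrable G := L2.integrable_inner _ _
  have hxG : ∀ᵐ x : ℝ, ⟪wave Y x, wave (displacement ω ∘L sqrtOp ρ) x⟫_ℂ = x * G x := by
    filter_upwards [wave_weightHamiltonian_ae hT hY hg] with x hx
    rw [hx, inner_smul_left, Complex.conj_ofReal]
  have hG' : Integrable fun x : ℝ => x • G x := by
    refine (L2.integrable_inner (𝕜 := ℂ) (wave Y) (wave (displacement ω ∘L sqrtOp ρ))).congr ?_
    filter_upwards [hxG] with x hx
    rw [hx, Complex.real_smul]
  have hchar : charFn ρ ω = fun s => 𝓕 G (-(1 / (2 * Real.pi)) * s) := by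
    ext s
    rw [charFn_eq_integral hρ, Real.fourier_real_eq_integral_exp_smul]
    refine integral_congr_ae ?_
    filter_upwards [wave_displacement_ae hT ω] with x hx
    simp only [G]
    rw [hx, smul_eq_mul]
    congr 2
    have : (Real.pi : ℂ) ≠ 0 := by exact_mod_cast Real.pi_ne_zero
    push_cast
    field_simp
  have hlin : HasDerivAt (fun s : ℝ => -(1 / (2 * Real.pi)) * s) (-(1 / (2 * Real.pi))) 0 := by
    simpa using (hasDerivAt_id (0 : ℝ)).const_mul (-(1 / (2 * Real.pi)))
  have hF : HasDerivAt (𝓕 G) (𝓕 (fun x : ℝ => (-2 * Real.pi * I * x) • G x) 0)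
      (-(1 / (2 * Real.pi)) * 0) := by
    rw [mul_zero]
    exact Real.hasDerivAt_fourier hG hG' 0
  rw [hchar]
  refine (hF.scomp (0 : ℝ) hlin).congr_deriv ?_
  rw [Real.fourier_real_eq_integral_exp_smul, ← inner_wave hY (hT.comp_left _), L2.inner_def,
    ← integral_const_mul, ← integral_smul]
  refine integral_congr_ae ?_
  filter_upwards [hxG] with x hx
  rw [hx]
  have : (Real.pi : ℂ) ≠ 0 := by exact_mod_cast Real.pi_ne_zero
  simp only [mul_zero, Complex.ofReal_zero, zero_mul, Complex.exp_zero, smul_eq_mul,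
    Complex.real_smul]
  push_cast
  field_simp

/-- The first-order condition at `s = 0` for a semi-classical state. -/
theorem IsSemiclassical.firstOrder {ρ Y : Weight →L[ℂ] Weight} {ρS : Matrix ι ι ℂ}
    (hsc : IsSemiclassical ε ρS ρ) (hρ : IsDensityOperator ρ)
    (hE : HasFiniteSecondMoment weightHamiltonian ρ) (hY : IsHilbertSchmidt Y)
    (hg : ∀ ψ, (sqrtOp ρ ψ, Y ψ) ∈ weightHamiltonian.graph) (i j : ι) :
    ρS i j * hsInner Y (displacement (ε i - ε j) ∘L sqrtOp ρ) =
      controlMarginal ε ρS ρ i j * (hsInner Y (sqrtOp ρ) + (ε i - ε j) / 2) := by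
  have h0 := hasDerivAt_charFn hρ hY hg 0
  rw [displacement_zero, ContinuousLinearMap.id_comp] at h0
  have h1 := hasDerivAt_charFn hρ hY hg (ε i - ε j)
  -- The denominator equals `1` at `s = 0`, so the semi-classical identity holds on a neighbourhood
  -- and may be differentiated there.
  have hne : ∀ᶠ s in nhds (0 : ℝ), charFn ρ 0 s ≠ 0 := by
    apply h0.continuousAt.eventually_ne
    rw [charFn_zero_zero hρ]
    exact one_ne_zero
  have heq : (fun s : ℝ => ρS i j *
      (cexp (-(I * (ε i - ε j : ℝ) * s / 2)) * charFn ρ (ε i - ε j) s)) =ᶠ[nhds 0]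
      fun s => controlMarginal ε ρS ρ i j * charFn ρ 0 s := by
    filter_upwards [hne] with s hs
    have h := congrFun (congrFun (hsc s (by rwa [xiDenominator_eq])) i) j
    rw [xi_apply hρ hE, div_eq_iff hs] at h
    exact h
  have hexp : HasDerivAt (fun s : ℝ => cexp (-(I * (ε i - ε j : ℝ) * s / 2)))
      (-(I * (ε i - ε j : ℝ) / 2)) 0 := by
    have h2 : HasDerivAt (fun s : ℝ => -(I * (ε i - ε j : ℝ) * (s : ℂ) / 2))
        (-(I * (ε i - ε j : ℝ) / 2)) 0 := by
      have := (hasDerivAt_id (0 : ℝ)).ofReal_comp.const_mul (-(I * (ε i - ε j : ℝ) / 2))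
      refine (this.congr_deriv (by simp)).congr_of_eventuallyEq (.of_forall fun s => ?_)
      simp only [id]
      ring
    simpa using h2.cexp
  have hd1 := (hexp.mul h1).const_mul (ρS i j)
  have hd2 := (h0.const_mul (controlMarginal ε ρS ρ i j)).congr_of_eventuallyEq heq
  have h := hd1.unique hd2
  simp only [Complex.ofReal_zero, mul_zero, zero_div, neg_zero, Complex.exp_zero, one_mul] at h
  rw [controlMarginal_eq_charFn hρ] at h ⊢
  apply mul_left_cancel₀ I_ne_zero
  push_cast at h
  linear_combination h

end Amplitudes

/-! ### Incoherent states and Gaussian packets -/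

section Examples

variable {ι : Type*} [Fintype ι] [DecidableEq ι] {ε : ι → ℝ} {ρS : Matrix ι ι ℂ}
  {ρW : Weight →L[ℂ] Weight}

/-- Commuting with `H_S` annihilates every entry between different energies; for equal energies the
displacement is trivial and the ratio of characteristic functions is `1`. -/
theorem isSemiclassical_of_commute (hρ : IsDensityOperator ρW)
    (hE : HasFiniteSecondMoment weightHamiltonian ρW)
    (h : Commute ρS (systemHamiltonian ε)) : IsSemiclassical ε ρS ρW := by
  intro s hs
  rw [xiDenominator_eq] at hs
  ext i j
  rw [xi_apply hρ hE, controlMarginal_eq_charFn hρ]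
  have hij := congrFun (congrFun h.eq i) j
  rw [systemHamiltonian, Matrix.mul_diagonal, Matrix.diagonal_mul] at hij
  by_cases he : ε i = ε j
  · rw [he, sub_self, charFn_zero_zero hρ]
    field_simp
    simp
  · have h0 : ρS i j = 0 := by
      have h1 : ((ε i : ℂ) - ε j) * ρS i j = 0 := by linear_combination -hij
      exact (mul_eq_zero.1 h1).resolve_left (sub_ne_zero.2 (by exact_mod_cast he))
    rw [h0]
    simp

theorem trace_comp_rankOne (A : Weight →L[ℂ] Weight) (ψ : Weight) :
    trace (A ∘L InnerProductSpace.rankOne ℂ ψ ψ) = ⟪ψ, A ψ⟫_ℂ := by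
  rw [← (onb Weight).tsum_inner_mul_inner ψ (A ψ)]
  refine tsum_congr fun k => ?_
  rw [ContinuousLinearMap.comp_apply, InnerProductSpace.rankOne_apply, map_smul, inner_smul_right]

/-- Completing the square about the midpoint, `x² + (x - ω)² = 2(x - ω/2)² + ω²/2`; division by
`4σ²` gives the constant `ω²/(8σ²)`. -/
theorem conj_gaussianWave_mul (μ ν σ ω s x : ℝ) (hσ : σ ≠ 0) :
    (starRingEnd ℂ) (gaussianWave μ ν σ x) * (cexp (I * x * s) * gaussianWave μ ν σ (x - ω)) =
      cexp (-(I * ν * ω) - ω ^ 2 / (8 * σ ^ 2)) * cexp (I * ω * s / 2) *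
        ((starRingEnd ℂ) (gaussianWave μ ν σ (x - ω / 2)) *
          (cexp (I * (x - ω / 2 : ℝ) * s) * gaussianWave μ ν σ (x - ω / 2))) := by
  have hσ' : (σ : ℂ) ≠ 0 := by exact_mod_cast hσ
  simp only [gaussianWave, map_mul, Complex.conj_ofReal, ← Complex.exp_conj, map_add, map_neg,
    map_div₀, map_one, map_pow, map_sub, Complex.conj_I, map_ofNat]
  set c : ℂ := (((2 * Real.pi * σ ^ 2) ^ (-(1 / 4 : ℝ)) : ℝ) : ℂ)
  have h1 : ∀ a b d : ℂ, c * cexp a * (cexp b * (c * cexp d)) = c * c * cexp (a + b + d) := by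
    intro a b d
    rw [Complex.exp_add, Complex.exp_add]
    ring
  have h2 : ∀ a b d : ℂ, cexp a * cexp b * (c * c * cexp d) = c * c * cexp (a + b + d) := by
    intro a b d
    rw [Complex.exp_add, Complex.exp_add]
    ring
  rw [h1, h1, h2]
  congr 2
  push_cast
  field_simp
  ring

/-- The overlap of a Gaussian with its translate is a constant times its density at the midpoint;
translating the integral by `ω/2` leaves the phase `e^{iωs/2}`, exactly what `xi_apply` cancels. -/
theorem charFn_gaussian (h : IsGaussianPacket ρW) (ω : ℝ) :
    ∃ C : ℂ, ∀ s : ℝ, charFn ρW ω s = C * cexp (I * ω * s / 2) * charFn ρW 0 s := by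
  obtain ⟨μ, ν, σ, ψ, hσ, hψ, rfl⟩ := h
  refine ⟨cexp (-(I * ν * ω) - ω ^ 2 / (8 * σ ^ 2)), fun s => ?_⟩
  have key : ∀ a : ℝ, charFn (InnerProductSpace.rankOne ℂ ψ ψ) a s =
      ∫ x : ℝ, (starRingEnd ℂ) (gaussianWave μ ν σ x) *
        (cexp (I * x * s) * gaussianWave μ ν σ (x - a)) := by
    intro a
    rw [charFn, trace_comp_rankOne, L2.inner_def]
    refine integral_congr_ae ?_
    filter_upwards [hψ, ae_comp_sub hψ a, expWeightHamiltonian_apply_ae s (displacement a ψ),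
      displacement_apply_ae a ψ] with x h1 h2 h3 h4
    rw [ContinuousLinearMap.comp_apply, h3, h4, h1, h2, RCLike.inner_apply, mul_comm]
  rw [key, key, ← integral_sub_right_eq_self (fun x : ℝ =>
    (starRingEnd ℂ) (gaussianWave μ ν σ x) * (cexp (I * x * s) * gaussianWave μ ν σ (x - 0)))
    (ω / 2), ← integral_const_mul]
  refine integral_congr_ae (Filter.Eventually.of_forall fun x => ?_)
  simp only
  rw [sub_zero, conj_gaussianWave_mul μ ν σ ω s x hσ.ne']

theorem isSemiclassical_of_gaussian (hρ : IsDensityOperator ρW)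
    (hE : HasFiniteSecondMoment weightHamiltonian ρW)
    (h : IsGaussianPacket ρW) : IsSemiclassical ε ρS ρW := by
  intro s hs
  rw [xiDenominator_eq] at hs
  ext i j
  obtain ⟨C, hC⟩ := charFn_gaussian h (ε i - ε j)
  rw [xi_apply hρ hE, controlMarginal_eq_charFn hρ, hC, hC, charFn_zero_zero hρ, Complex.exp_neg]
  have := Complex.exp_ne_zero (I * (ε i - ε j : ℝ) * s / 2)
  field_simp
  simp

end Examples

/-! ### Covariances in the control state and the variance change -/

section Main

variable {ι : Type*} [Fintype ι] [DecidableEq ι] {ε : ι → ℝ} {V s : Matrix ι ι ℂ}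
  {ρ Y : Weight →L[ℂ] Weight}

theorem isHermitian_systemHamiltonian (ε : ι → ℝ) : (systemHamiltonian ε).IsHermitian :=
  Matrix.isHermitian_diagonal_of_self_adjoint _ (by
    ext i
    simp)

theorem isHermitian_rotatedHamiltonian (ε : ι → ℝ) (V : Matrix ι ι ℂ) :
    (rotatedHamiltonian ε V).IsHermitian :=
  Matrix.isHermitian_conjTranspose_mul_mul _ (isHermitian_systemHamiltonian ε)

theorem adjoint_jointSystemOp_of_isHermitian {A : Matrix ι ι ℂ} (hA : A.IsHermitian) :
    ContinuousLinearMap.adjoint (jointSystemOp A) = jointSystemOp A := by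
  rw [adjoint_jointSystemOp, hA.eq]

theorem mem_graph_controlAmp (hg : ∀ ψ, (sqrtOp ρ ψ, Y ψ) ∈ weightHamiltonian.graph)
    (Ψ : Joint ι) :
    (controlAmp ε s (sqrtOp ρ) Ψ, weightAmp ε s (sqrtOp ρ) Y Ψ) ∈
      jointWeightHamiltonian.graph :=
  mem_graph_shiftOp (mem_graph_tensorOp hg s Ψ) ε

theorem adjoint_shiftOp_controlAmp (T : Weight →L[ℂ] Weight) :
    ContinuousLinearMap.adjoint (shiftOp ε) ∘L controlAmp ε s T = tensorOp s T := by
  rw [controlAmp, ← ContinuousLinearMap.comp_assoc, adjoint_shiftOp_comp,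
    ContinuousLinearMap.id_comp]

theorem mem_graph_initial (hg : ∀ ψ, (sqrtOp ρ ψ, Y ψ) ∈ weightHamiltonian.graph)
    (Ψ : Joint ι) :
    (tensorOp s (sqrtOp ρ) Ψ, (ContinuousLinearMap.adjoint (shiftOp ε) ∘L
      (weightAmp ε s (sqrtOp ρ) Y -
        jointSystemOp (systemHamiltonian ε) ∘L controlAmp ε s (sqrtOp ρ))) Ψ) ∈
      jointWeightHamiltonian.graph := by
  rw [← adjoint_shiftOp_controlAmp (ε := ε)]
  exact mem_graph_adjoint_shiftOp (mem_graph_controlAmp hg Ψ) ε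

/-- Here `U√ρ = S†VQ`, so `H_W` acts on it as `S†(H_W - H_S)VQ`. Then `U†S† = S†V†` brings `V†` to
the left, and `V†V = 1` leaves `P` unchanged. -/
theorem mem_graph_final (hV : V ∈ Matrix.unitaryGroup ι ℂ)
    (hg : ∀ ψ, (sqrtOp ρ ψ, Y ψ) ∈ weightHamiltonian.graph) (Ψ : Joint ι) :
    (tensorOp s (sqrtOp ρ) Ψ, (ContinuousLinearMap.adjoint (shiftOp ε) ∘L
      (weightAmp ε s (sqrtOp ρ) Y -
        jointSystemOp (rotatedHamiltonian ε V) ∘L controlAmp ε s (sqrtOp ρ))) Ψ) ∈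
      (conjBy (workUnitary ε V) jointWeightHamiltonian).graph := by
  have h1 := mem_graph_adjoint_shiftOp (mem_graph_jointSystemOp
    (mem_graph_controlAmp (ε := ε) (s := s) hg Ψ) V) ε
  have h2 : ContinuousLinearMap.adjoint (shiftOp ε)
      (jointSystemOp V (controlAmp ε s (sqrtOp ρ) Ψ)) =
      workUnitary ε V (tensorOp s (sqrtOp ρ) Ψ) := rfl
  rw [h2] at h1
  have h3 := mem_graph_conjBy h1
  convert h3 using 2
  have hVV : V.conjTranspose * V = 1 := Matrix.mem_unitaryGroup_iff'.1 hV
  have e : ∀ Θ : Joint ι, ContinuousLinearMap.adjoint (workUnitary ε V)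
      (ContinuousLinearMap.adjoint (shiftOp ε) Θ) =
      ContinuousLinearMap.adjoint (shiftOp ε) (jointSystemOp V.conjTranspose Θ) := by
    intro Θ
    have h4 : shiftOp ε (ContinuousLinearMap.adjoint (shiftOp ε) Θ) = Θ :=
      congrArg (fun X : Joint ι →L[ℂ] Joint ι => X Θ) (shiftOp_comp_adjoint ε)
    rw [workUnitary, ContinuousLinearMap.adjoint_comp, ContinuousLinearMap.adjoint_comp,
      ContinuousLinearMap.adjoint_adjoint, adjoint_jointSystemOp]
    simp only [ContinuousLinearMap.comp_apply, h4]
  rw [e, map_sub]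
  simp only [← ContinuousLinearMap.comp_apply]
  rw [← ContinuousLinearMap.comp_assoc, jointSystemOp_comp, hVV, jointSystemOp_one,
    ContinuousLinearMap.id_comp, ← ContinuousLinearMap.comp_assoc, jointSystemOp_comp,
    ← ContinuousLinearMap.comp_assoc, jointSystemOp_comp]
  rfl

theorem mem_graph_control (hg : ∀ ψ, (sqrtOp ρ ψ, Y ψ) ∈ weightHamiltonian.graph)
    (Ψ : Joint ι) :
    ((controlAmp ε s (sqrtOp ρ) ∘L ContinuousLinearMap.adjoint (shiftOp ε)) Ψ,
      (weightAmp ε s (sqrtOp ρ) Y ∘L ContinuousLinearMap.adjoint (shiftOp ε)) Ψ) ∈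
      jointWeightHamiltonian.graph :=
  mem_graph_controlAmp hg _

/-- The square root of `σ` is `Q S†`; cyclicity removes the trailing `S†`, so moments in `σ` are
computed with `Q` itself. -/
theorem hsInner_comp_adjoint_shiftOp {X Z : Joint ι →L[ℂ] Joint ι} (hX : IsHilbertSchmidt X)
    (hZ : IsHilbertSchmidt Z) :
    hsInner (X ∘L ContinuousLinearMap.adjoint (shiftOp ε))
      (Z ∘L ContinuousLinearMap.adjoint (shiftOp ε)) = hsInner X Z := by
  rw [hsInner_comp_right (hX.comp_right _) hZ, ContinuousLinearMap.comp_assoc,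
    adjoint_shiftOp_comp, ContinuousLinearMap.comp_id]

theorem hsInner_adjoint_shiftOp_comp (X Z : Joint ι →L[ℂ] Joint ι) :
    hsInner (ContinuousLinearMap.adjoint (shiftOp ε) ∘L X)
      (ContinuousLinearMap.adjoint (shiftOp ε) ∘L Z) = hsInner X Z := by
  rw [hsInner_comp_left, ContinuousLinearMap.adjoint_adjoint, ← ContinuousLinearMap.comp_assoc,
    shiftOp_comp_adjoint, ContinuousLinearMap.id_comp]

theorem hsInner_controlAmp (hρ : IsDensityOperator ρ) (hs : s.IsHermitian) (A : Matrix ι ι ℂ) :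
    hsInner (controlAmp ε s (sqrtOp ρ)) (jointSystemOp A ∘L controlAmp ε s (sqrtOp ρ)) =
      systemMean (controlMarginal ε (s * s) ρ) A := by
  have hT := hρ.isHilbertSchmidt_sqrt
  rw [hsInner_systemOp_of_component hs (isHilbertSchmidt_controlAmp hT)
    (isHilbertSchmidt_controlAmp hT) (fun i => hT.comp_left _) controlAmp_component
    controlAmp_component (fun i => hT.comp_left _), systemMean, Matrix.trace]
  simp only [Matrix.diag_apply, Matrix.mul_apply (M := A), controlMarginal_apply hρ]

/-- `P` contributes the energy `ε i` on top of the first-order term `(ε l - ε i)/2`. The sum is the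
symmetric mean `(ε l + ε i)/2`, which is half the anticommutator of `H_S` with `A`. -/
theorem hsInner_weightAmp (hρ : IsDensityOperator ρ)
    (hE : HasFiniteSecondMoment weightHamiltonian ρ) (hY : IsHilbertSchmidt Y)
    (hg : ∀ ψ, (sqrtOp ρ ψ, Y ψ) ∈ weightHamiltonian.graph) (hs : s.IsHermitian)
    (hsc : IsSemiclassical ε (s * s) ρ) (A : Matrix ι ι ℂ) :
    hsInner (weightAmp ε s (sqrtOp ρ) Y) (jointSystemOp A ∘L controlAmp ε s (sqrtOp ρ)) =
      hsInner Y (sqrtOp ρ) * systemMean (controlMarginal ε (s * s) ρ) A +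
        1 / 2 * (systemMean (controlMarginal ε (s * s) ρ) (systemHamiltonian ε * A) +
          systemMean (controlMarginal ε (s * s) ρ) (A * systemHamiltonian ε)) := by
  have hT := hρ.isHilbertSchmidt_sqrt
  have hYT : ∀ i, IsHilbertSchmidt (Y + (ε i : ℂ) • sqrtOp ρ) := fun i => hY.add (hT.smul _)
  rw [hsInner_systemOp_of_component hs (isHilbertSchmidt_weightAmp hT hY)
    (isHilbertSchmidt_controlAmp hT) (fun i => hT.comp_left _) weightAmp_component
    controlAmp_component (fun i => (hYT i).comp_left _)]
  have h : ∀ i l, (s * s) l i * hsInner (displacement (ε i) ∘L (Y + (ε i : ℂ) • sqrtOp ρ))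
      (displacement (ε l) ∘L sqrtOp ρ) = controlMarginal ε (s * s) ρ l i *
        (hsInner Y (sqrtOp ρ) + (ε l + ε i) / 2) := by
    intro i l
    have h1 := hsc.firstOrder hρ hE hY hg l i
    have h2 := controlMarginal_eq_charFn (ε := ε) hρ (s * s) l i
    rw [charFn_zero_right hρ] at h2
    rw [hsInner_displacement, hsInner_add_left hY (hT.smul _) (hT.comp_left _), mul_add, h1,
      hsInner_smul_left, Complex.conj_ofReal, mul_left_comm, ← h2]
    ring
  simp only [h, systemMean, Matrix.trace, Matrix.diag_apply, systemHamiltonian,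
    Matrix.mul_apply (N := controlMarginal ε (s * s) ρ), Matrix.diagonal_mul, Matrix.mul_diagonal]
  simp only [Finset.mul_sum, ← Finset.sum_add_distrib]
  refine Finset.sum_congr rfl fun i _ => Finset.sum_congr rfl fun l _ => ?_
  ring

theorem hsInner_self_im (X : Joint ι →L[ℂ] Joint ι) : (hsInner X X).im = 0 := by
  rw [hsInner_self, Complex.ofReal_im]

theorem systemMean_im (hρ : IsDensityOperator ρ) (hs : s.IsHermitian) {A : Matrix ι ι ℂ}
    (hA : A.IsHermitian) : (systemMean (controlMarginal ε (s * s) ρ) A).im = 0 := by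
  rw [← hsInner_controlAmp hρ hs, ← Complex.conj_eq_iff_im, hsInner_conj_symm, hsInner_comp_left,
    adjoint_jointSystemOp_of_isHermitian hA]

theorem hsInner_re_comm {X Z : Joint ι →L[ℂ] Joint ι} :
    (hsInner X Z).re = (hsInner Z X).re := by
  rw [← hsInner_conj_symm, Complex.conj_re]

/-- `Re⟨(H_S - H_W) S√ρ, A S√ρ⟩ = -⟨H_W⟩ ⟨A⟩` for a semi-classical state. -/
theorem hsInner_energyDifference (hρ : IsDensityOperator ρ)
    (hE : HasFiniteSecondMoment weightHamiltonian ρ) (hY : IsHilbertSchmidt Y)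
    (hg : ∀ ψ, (sqrtOp ρ ψ, Y ψ) ∈ weightHamiltonian.graph) (hs : s.IsHermitian)
    (hsc : IsSemiclassical ε (s * s) ρ) {A : Matrix ι ι ℂ} (hA : A.IsHermitian) :
    (hsInner (jointSystemOp (systemHamiltonian ε) ∘L controlAmp ε s (sqrtOp ρ) -
        weightAmp ε s (sqrtOp ρ) Y) (jointSystemOp A ∘L controlAmp ε s (sqrtOp ρ))).re =
      -(hsInner Y (sqrtOp ρ)).re *
        (hsInner (controlAmp ε s (sqrtOp ρ))
          (jointSystemOp A ∘L controlAmp ε s (sqrtOp ρ))).re := by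
  have hT := hρ.isHilbertSchmidt_sqrt
  have hQ : IsHilbertSchmidt (controlAmp ε s (sqrtOp ρ)) := isHilbertSchmidt_controlAmp hT
  have hH := isHermitian_systemHamiltonian ε
  have e1 : hsInner (jointSystemOp (systemHamiltonian ε) ∘L controlAmp ε s (sqrtOp ρ))
      (jointSystemOp A ∘L controlAmp ε s (sqrtOp ρ)) =
      systemMean (controlMarginal ε (s * s) ρ) (systemHamiltonian ε * A) := by
    rw [hsInner_comp_left, adjoint_jointSystemOp_of_isHermitian hH,
      ← ContinuousLinearMap.comp_assoc, jointSystemOp_comp, hsInner_controlAmp hρ hs]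
  -- The two orderings are complex conjugates, so the symmetrized product has the same real part as
  -- `H_S A` and cancels against `e1`.
  have e2 : (systemMean (controlMarginal ε (s * s) ρ) (A * systemHamiltonian ε)).re =
      (systemMean (controlMarginal ε (s * s) ρ) (systemHamiltonian ε * A)).re := by
    rw [← e1, hsInner_re_comm, hsInner_comp_left, adjoint_jointSystemOp_of_isHermitian hA,
      ← ContinuousLinearMap.comp_assoc, jointSystemOp_comp, hsInner_controlAmp hρ hs]
  rw [hsInner_sub_left (hQ.comp_left _) (isHilbertSchmidt_weightAmp hT hY) (hQ.comp_left _), e1,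
    hsInner_weightAmp hρ hE hY hg hs hsc, hsInner_controlAmp hρ hs, Complex.sub_re, Complex.add_re,
    Complex.mul_re, systemMean_im hρ hs hA,
    show (1 / 2 : ℂ) = ((1 / 2 : ℝ) : ℂ) by push_cast; rfl, Complex.re_ofReal_mul, Complex.add_re,
    e2]
  ring

theorem sqrtOp_controlState_eq (hs : s.PosSemidef) (hρ : IsDensityOperator ρ) :
    sqrtOp (controlState ε (s * s) ρ) = controlAmp ε s (sqrtOp ρ) ∘L
      ContinuousLinearMap.adjoint (shiftOp ε) := by
  rw [sqrtOp_controlState ε hs hρ.isPositive, controlAmp, ContinuousLinearMap.comp_assoc]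

theorem hsInner_controlAmp_self (hs : s.PosSemidef) (hss : (s * s).trace = 1)
    (hρ : IsDensityOperator ρ) :
    hsInner (controlAmp ε s (sqrtOp ρ)) (controlAmp ε s (sqrtOp ρ)) = 1 := by
  have h := hsInner_controlAmp (ε := ε) hρ hs.1 1
  rw [jointSystemOp_one, ContinuousLinearMap.id_comp, systemMean, one_mul, Matrix.trace] at h
  simp only [Matrix.diag_apply, controlMarginal_eq_charFn hρ, sub_self, charFn_zero_zero hρ,
    mul_one] at h
  rw [h]
  exact hss

theorem hasFiniteSecondMoment_initial (hs : s.PosSemidef) (hρ : IsDensityOperator ρ)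
    (hY : IsHilbertSchmidt Y) (hg : ∀ ψ, (sqrtOp ρ ψ, Y ψ) ∈ weightHamiltonian.graph) :
    HasFiniteSecondMoment jointWeightHamiltonian (tensorOp (s * s) ρ) := by
  refine hasFiniteSecondMoment_of_graph (hY.tensorOp s) fun Ψ => ?_
  rw [sqrtOp_tensorOp hs hρ.isPositive]
  exact mem_graph_tensorOp hg s Ψ

theorem hasFiniteSecondMoment_final (hV : V ∈ Matrix.unitaryGroup ι ℂ) (hs : s.PosSemidef)
    (hρ : IsDensityOperator ρ) (hY : IsHilbertSchmidt Y)
    (hg : ∀ ψ, (sqrtOp ρ ψ, Y ψ) ∈ weightHamiltonian.graph) :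
    HasFiniteSecondMoment (conjBy (workUnitary ε V) jointWeightHamiltonian)
      (tensorOp (s * s) ρ) := by
  have hT := hρ.isHilbertSchmidt_sqrt
  have h : ∀ Ψ, _ ∈ LinearPMap.graph _ := mem_graph_final (ε := ε) (s := s) hV hg
  rw [← sqrtOp_tensorOp hs hρ.isPositive] at h
  exact hasFiniteSecondMoment_of_graph (((isHilbertSchmidt_weightAmp hT hY).sub
    ((isHilbertSchmidt_controlAmp hT).comp_left _)).comp_left _) h

theorem hasFiniteSecondMoment_control (hs : s.PosSemidef) (hρ : IsDensityOperator ρ)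
    (hY : IsHilbertSchmidt Y) (hg : ∀ ψ, (sqrtOp ρ ψ, Y ψ) ∈ weightHamiltonian.graph) :
    HasFiniteSecondMoment jointWeightHamiltonian (controlState ε (s * s) ρ) := by
  have h : ∀ Ψ, _ ∈ LinearPMap.graph _ := mem_graph_control (ε := ε) (s := s) hg
  rw [← sqrtOp_controlState_eq hs hρ] at h
  exact hasFiniteSecondMoment_of_graph
    ((isHilbertSchmidt_weightAmp hρ.isHilbertSchmidt_sqrt hY).comp_right _) h

theorem fTerm_eq_zero (hs : s.PosSemidef) (hss : (s * s).trace = 1) (hρ : IsDensityOperator ρ)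
    (hE : HasFiniteSecondMoment weightHamiltonian ρ) (hY : IsHilbertSchmidt Y)
    (hg : ∀ ψ, (sqrtOp ρ ψ, Y ψ) ∈ weightHamiltonian.graph)
    (hsc : IsSemiclassical ε (s * s) ρ) : fTerm ε V (s * s) ρ = 0 := by
  have hT := hρ.isHilbertSchmidt_sqrt
  have hQ : IsHilbertSchmidt (controlAmp ε s (sqrtOp ρ)) := isHilbertSchmidt_controlAmp hT
  have hB : IsHilbertSchmidt (jointSystemOp (systemHamiltonian ε) ∘L controlAmp ε s (sqrtOp ρ) -
      weightAmp ε s (sqrtOp ρ) Y) :=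
    (hQ.comp_left _).sub (isHilbertSchmidt_weightAmp hT hY)
  have hR : IsHilbertSchmidt (jointSystemOp (rotatedHamiltonian ε V) ∘L
      controlAmp ε s (sqrtOp ρ)) := hQ.comp_left _
  have hroot := sqrtOp_controlState_eq (ε := ε) hs hρ
  rw [fTerm, cov_eq_hsInner (by rw [hroot]; exact hQ.comp_right _)
    (hB.comp_right (ContinuousLinearMap.adjoint (shiftOp ε)))
    (hR.comp_right (ContinuousLinearMap.adjoint (shiftOp ε)))
    (fun Ψ => by
      rw [hroot]
      exact mem_graph_sub (mem_graph_ofBounded _ _) (mem_graph_control hg Ψ))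
    (fun Ψ => by
      rw [hroot]
      exact mem_graph_ofBounded _ _), hroot, hsInner_comp_adjoint_shiftOp hB hR,
    hsInner_comp_adjoint_shiftOp hQ hB, hsInner_comp_adjoint_shiftOp hQ hR,
    hsInner_energyDifference hρ hE hY hg hs.1 hsc (isHermitian_rotatedHamiltonian ε V)]
  -- With `A = 1` and `⟨Q, Q⟩ = 1` this is the mean of `H_S - H_W`, so the covariance is the
  -- difference of two equal products.
  have h1 := hsInner_energyDifference hρ hE hY hg hs.1 hsc Matrix.isHermitian_one
  rw [jointSystemOp_one, ContinuousLinearMap.id_comp, hsInner_controlAmp_self hs hss hρ,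
    Complex.one_re, mul_one] at h1
  rw [hsInner_re_comm (X := controlAmp ε s (sqrtOp ρ)) (Z := _ - _), h1]
  ring

theorem varianceChange_eq (hV : V ∈ Matrix.unitaryGroup ι ℂ) (hs : s.PosSemidef)
    (hss : (s * s).trace = 1) (hρ : IsDensityOperator ρ)
    (hE : HasFiniteSecondMoment weightHamiltonian ρ) (hY : IsHilbertSchmidt Y)
    (hg : ∀ ψ, (sqrtOp ρ ψ, Y ψ) ∈ weightHamiltonian.graph)
    (hsc : IsSemiclassical ε (s * s) ρ) :
    varianceChange ε V (s * s) ρ =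
      (hsInner (jointSystemOp (workOperator ε V) ∘L controlAmp ε s (sqrtOp ρ))
        (jointSystemOp (workOperator ε V) ∘L controlAmp ε s (sqrtOp ρ))).re -
      (hsInner (controlAmp ε s (sqrtOp ρ))
        (jointSystemOp (workOperator ε V) ∘L controlAmp ε s (sqrtOp ρ))).re ^ 2 := by
  have hT := hρ.isHilbertSchmidt_sqrt
  have hQ : IsHilbertSchmidt (controlAmp ε s (sqrtOp ρ)) := isHilbertSchmidt_controlAmp hT
  have hroot := sqrtOp_tensorOp hs hρ.isPositive
  have hP := isHilbertSchmidt_weightAmp (ε := ε) (s := s) hT hY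
  -- Every amplitude here carries a leading `S†`, and so does `√ρ = S†Q`; unitarity removes it from
  -- all inner products.
  have hvar : ∀ {A : Joint ι →ₗ.[ℂ] Joint ι} {Z : Joint ι →L[ℂ] Joint ι}, IsHilbertSchmidt Z →
      (∀ Ψ, (tensorOp s (sqrtOp ρ) Ψ,
        (ContinuousLinearMap.adjoint (shiftOp ε) ∘L Z) Ψ) ∈ A.graph) →
      var (tensorOp (s * s) ρ) A = (hsInner Z Z).re -
        (hsInner (controlAmp ε s (sqrtOp ρ)) Z).re ^ 2 := by
    intro A Z hZ h
    rw [← hroot] at h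
    rw [var, cov_eq_hsInner (by rw [hroot]; exact hT.tensorOp s) (hZ.comp_left _) (hZ.comp_left _)
      h h, hroot, ← adjoint_shiftOp_controlAmp (ε := ε), hsInner_adjoint_shiftOp_comp,
      hsInner_adjoint_shiftOp_comp, sq]
  rw [varianceChange, hvar (hP.sub (hQ.comp_left _)) (mem_graph_final hV hg),
    hvar (hP.sub (hQ.comp_left _)) (mem_graph_initial hg)]
  set Q := controlAmp ε s (sqrtOp ρ)
  set P := weightAmp ε s (sqrtOp ρ) Y
  set B := jointSystemOp (systemHamiltonian ε) ∘L Q - P with hBdef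
  have hW : (workOperator ε V).IsHermitian :=
    (isHermitian_systemHamiltonian ε).sub (isHermitian_rotatedHamiltonian ε V)
  have h1 := hsInner_energyDifference hρ hE hY hg hs.1 hsc Matrix.isHermitian_one
  have h2 := hsInner_energyDifference hρ hE hY hg hs.1 hsc hW
  rw [jointSystemOp_one, ContinuousLinearMap.id_comp, hsInner_controlAmp_self hs hss hρ,
    Complex.one_re, mul_one] at h1
  have hB : IsHilbertSchmidt B := (hQ.comp_left _).sub hP
  have hX : IsHilbertSchmidt (jointSystemOp (workOperator ε V) ∘L Q) := hQ.comp_left _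
  -- In terms of `B` the evolved amplitude is `W_S Q - B` and the initial one is `-B`: `Var[B]`
  -- cancels in the difference, and only the cross term, killed by `h1` and `h2`, separates the rest
  -- from the variance of `W_S`.
  have eW : P - jointSystemOp (rotatedHamiltonian ε V) ∘L Q =
      jointSystemOp (workOperator ε V) ∘L Q - B := by
    rw [hBdef, workOperator, jointSystemOp_sub, ContinuousLinearMap.sub_comp]
    abel
  have eH : P - jointSystemOp (systemHamiltonian ε) ∘L Q = (-1 : ℂ) • B := by
    rw [hBdef]
    module
  rw [eW, eH, hsInner_sub_left hX hB (hX.sub hB), hsInner_sub_right hX hX hB,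
    hsInner_sub_right hB hX hB, hsInner_sub_right hQ hX hB, hsInner_smul_left, hsInner_smul_right,
    hsInner_smul_right]
  simp only [Complex.sub_re, map_neg, map_one, neg_mul, one_mul, neg_neg, Complex.neg_re]
  rw [hsInner_re_comm (X := jointSystemOp (workOperator ε V) ∘L Q) (Z := B),
    hsInner_re_comm (X := Q) (Z := B), h1, h2]
  ring

/-- Expand `‖X - wQ‖² ≥ 0` with `w` the real part of `⟨Q, X⟩`. Applied to `X = W_S Q` this is the
nonnegativity of the variance. -/
theorem sq_re_hsInner_le {X Q : Joint ι →L[ℂ] Joint ι} (hX : IsHilbertSchmidt X)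
    (hQ : IsHilbertSchmidt Q) (h1 : hsInner Q Q = 1) :
    (hsInner Q X).re ^ 2 ≤ (hsInner X X).re := by
  set w : ℝ := (hsInner Q X).re
  have h := hsInner_self_re_nonneg (X - (w : ℂ) • Q)
  rw [hsInner_sub_left hX (hQ.smul _) (hX.sub (hQ.smul _)), hsInner_sub_right hX hX (hQ.smul _),
    hsInner_sub_right (hQ.smul _) hX (hQ.smul _), hsInner_smul_left, hsInner_smul_left,
    hsInner_smul_right, hsInner_smul_right, h1, Complex.conj_ofReal] at h
  simp only [Complex.sub_re, Complex.re_ofReal_mul, mul_one, Complex.ofReal_re] at h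
  rw [hsInner_re_comm (X := X) (Z := Q)] at h
  change 0 ≤ _ - w * w - (w * w - w * w) at h
  linarith

theorem varianceChange_eq_systemVar (hV : V ∈ Matrix.unitaryGroup ι ℂ) (hs : s.PosSemidef)
    (hss : (s * s).trace = 1) (hρ : IsDensityOperator ρ)
    (hE : HasFiniteSecondMoment weightHamiltonian ρ) (hY : IsHilbertSchmidt Y)
    (hg : ∀ ψ, (sqrtOp ρ ψ, Y ψ) ∈ weightHamiltonian.graph)
    (hsc : IsSemiclassical ε (s * s) ρ) :
    (varianceChange ε V (s * s) ρ : ℂ) =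
      systemVar (controlMarginal ε (s * s) ρ) (workOperator ε V) := by
  have hW : (workOperator ε V).IsHermitian :=
    (isHermitian_systemHamiltonian ε).sub (isHermitian_rotatedHamiltonian ε V)
  have hre : ∀ z : ℂ, z.im = 0 → ((z.re : ℝ) : ℂ) = z := fun z hz =>
    Complex.ext (by simp) (by simp [hz])
  rw [varianceChange_eq hV hs hss hρ hE hY hg hsc, Complex.ofReal_sub, Complex.ofReal_pow,
    hre _ (hsInner_self_im _), hsInner_controlAmp hρ hs.1, hre _ (systemMean_im hρ hs.1 hW),
    hsInner_comp_left, adjoint_jointSystemOp_of_isHermitian hW, ← ContinuousLinearMap.comp_assoc,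
    jointSystemOp_comp, hsInner_controlAmp hρ hs.1, systemVar, systemCov]
  simp only [systemMean, add_mul, Matrix.trace_add]
  ring

end Main

end QuantumWeight

end

theorem corollary1 {ι : Type*} [Fintype ι] [DecidableEq ι]
    (ε : ι → ℝ) (V : Matrix ι ι ℂ) (hV : V ∈ Matrix.unitaryGroup ι ℂ)
    (ρS : Matrix ι ι ℂ) (hρS : QuantumWeight.IsDensityMatrix ρS)
    (ρW : QuantumWeight.Weight →L[ℂ] QuantumWeight.Weight)
    (hρW : QuantumWeight.IsDensityOperator ρW)
    (hE : QuantumWeight.HasFiniteSecondMoment QuantumWeight.weightHamiltonian ρW) :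
    -- the means, variances and covariances below are those of well-defined second moments
    (QuantumWeight.HasFiniteSecondMoment QuantumWeight.jointWeightHamiltonian
        (QuantumWeight.tensorOp ρS ρW) ∧
      QuantumWeight.HasFiniteSecondMoment
        (QuantumWeight.conjBy (QuantumWeight.workUnitary ε V)
          QuantumWeight.jointWeightHamiltonian)
        (QuantumWeight.tensorOp ρS ρW) ∧
      QuantumWeight.HasFiniteSecondMoment QuantumWeight.jointWeightHamiltonian
        (QuantumWeight.controlState ε ρS ρW)) ∧
    -- semi-classical states
    (QuantumWeight.IsSemiclassical ε ρS ρW →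
      QuantumWeight.fTerm ε V ρS ρW = 0 ∧
      (QuantumWeight.varianceChange ε V ρS ρW : ℂ) =
        QuantumWeight.systemVar (QuantumWeight.controlMarginal ε ρS ρW)
          (QuantumWeight.workOperator ε V) ∧
      0 ≤ QuantumWeight.varianceChange ε V ρS ρW) ∧
    -- Gaussian wave packets and incoherent system states are semi-classical
    (QuantumWeight.IsGaussianPacket ρW → QuantumWeight.IsSemiclassical ε ρS ρW) ∧
    (Commute ρS (QuantumWeight.systemHamiltonian ε) →
      QuantumWeight.IsSemiclassical ε ρS ρW) := by
  -- Writing `ρS` as `s * s` makes `s ⊗ √ρW` the explicit square root of the joint state.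
  obtain ⟨s, hs, rfl⟩ := QuantumWeight.exists_posSemidef_sqrt hρS.posSemidef
  obtain ⟨Y, hY, hg⟩ := QuantumWeight.exists_weightHamiltonian_comp_sqrt hE
  have hss := hρS.trace_one
  refine ⟨⟨QuantumWeight.hasFiniteSecondMoment_initial hs hρW hY hg,
    QuantumWeight.hasFiniteSecondMoment_final hV hs hρW hY hg,
    QuantumWeight.hasFiniteSecondMoment_control hs hρW hY hg⟩, fun hsc =>
    ⟨QuantumWeight.fTerm_eq_zero hs hss hρW hE hY hg hsc,
      QuantumWeight.varianceChange_eq_systemVar hV hs hss hρW hE hY hg hsc, ?_⟩,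
    QuantumWeight.isSemiclassical_of_gaussian hρW hE,
    QuantumWeight.isSemiclassical_of_commute hρW hE⟩
  have hQ := QuantumWeight.isHilbertSchmidt_controlAmp (ε := ε) (s := s)
    hρW.isHilbertSchmidt_sqrt
  rw [QuantumWeight.varianceChange_eq hV hs hss hρW hE hY hg hsc]
  exact sub_nonneg.2 (QuantumWeight.sq_re_hsInner_le (hQ.comp_left _) hQ
    (QuantumWeight.hsInner_controlAmp_self hs hss hρW))
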